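/- Let $d\ge 1$, let $0<\mu_1\le\mu_2\le\cdots$ be an increasing sequence of real numbers, and let $K\subseteq\mathbb{R}^d$ be a convex body (compact, convex, with non-empty interior) with diameter $\delta_K$ and Lebesgue measure $|K|$. Assume that $$\sum_{j=1}^\infty \frac1{\mu_j} > \delta_K e \qquad (\text{the sum may be } \infty),$$ and let $N$ be the positive integer $$N := 1+\sup\Big\{n\in\mathbb{N} : \sum_{j=1}^{n}\frac{1}{\delta_K\mu_j}<e\Big\}.$$ Let $\tilde\mu:[1,\infty)\to(0,\infty)$ be any increasing, continuous, piecewise $\mathcal{C}^1$ function with $\tilde\mu(k)=\mu_k$ for all integers $k\ge1$, and, if $N\geq 2$, put $$C_N := 4\exp\Big(4+\sup_{1\le s\le 2(N-1)}\frac{s\,\tilde\mu'(s)}{\tilde\mu(s)}\Big),$$ where $\tilde\mu'$ denotes the left derivative at points where $\tilde\mu$ is not differentiable (and the right derivative at $s=1$). For $f$ defined and sufficiently often differentiable near $K$ write $\|f\|_K:=\sup_{x\in K}|f(x)|$ and $\|f\|_{j,K}:=\sum_{|\alpha|=j}\frac{j!}{\alpha!}\|f^{(\alpha)}\|_K$.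 Let $f$ be $(\mu^{|2(N-1)},\|f\|_K)$-smooth, i.e. $f$ is a real-valued function of class $\mathcal{C}^{2(N-1)}$ in an open neighborhood of $K$, $\|f\|_K>0$, and $$\|f\|_{j,K}\le \|f\|_K\,\mu_1\mu_2\cdots\mu_j,\qquad 0\le j\le 2(N-1).$$ Then the sublevel sets $S_t:=\{x\in K: |f(x)|\le t\}$ satisfy $$|S_t|\le C_N\, d\,|K|\Big(\frac{t}{\|f\|_K}\Big)^{\frac1{2(N-1)}},\qquad t>0,$$ with the understanding that the right-hand side is $\infty$ if $N-1=0$. -/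

import Mathlib

open MeasureTheory Set

noncomputable section

namespace Remez

/-- A convex body in `ℝ^d`: a compact convex set with non-empty interior. -/
structure IsConvexBody {d : ℕ} (K : Set (EuclideanSpace ℝ (Fin d))) : Prop where
  convex : Convex ℝ K
  compact : IsCompact K
  interior_nonempty : (interior K).Nonempty

/-- The sup-norm `‖g‖_K = sup_{x ∈ K} |g x|`. -/
def supNorm {d : ℕ} (K : Set (EuclideanSpace ℝ (Fin d))) (g : EuclideanSpace ℝ (Fin d) → ℝ) : ℝ :=
  sSup ((fun x => |g x|) '' K)

/-- The partial derivative `∂g/∂x_i`. -/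
def partialDeriv {d : ℕ} (i : Fin d) (g : EuclideanSpace ℝ (Fin d) → ℝ) :
    EuclideanSpace ℝ (Fin d) → ℝ :=
  fun x => lineDeriv ℝ g x (EuclideanSpace.single i (1 : ℝ))

/-- `f^{(α)} = ∂_1^{α_1} ⋯ ∂_d^{α_d} f` for a multi-index `α`. -/
def multiDeriv {d : ℕ} (α : Fin d → ℕ) (f : EuclideanSpace ℝ (Fin d) → ℝ) :
    EuclideanSpace ℝ (Fin d) → ℝ :=
  (List.finRange d).foldr (fun i g => (partialDeriv i)^[α i] g) f

/-- `‖f‖_{j,K} = ∑_{|α| = j} (j! / α!) ‖f^{(α)}‖_K`. -/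
def derivNorm {d : ℕ} (j : ℕ) (K : Set (EuclideanSpace ℝ (Fin d)))
    (f : EuclideanSpace ℝ (Fin d) → ℝ) : ℝ :=
  ∑ α ∈ Finset.piAntidiag (Finset.univ : Finset (Fin d)) j,
    ((j.factorial : ℝ) / ∏ i, ((α i).factorial : ℝ)) * supNorm K (multiDeriv α f)

/-- An (everywhere finite) admissible weight `0 < μ_1 ≤ μ_2 ≤ ⋯`; the value `μ 0` plays no role. -/
structure IsAdmissibleWeight (μ : ℕ → ℝ) : Prop where
  pos : ∀ j, 1 ≤ j → 0 < μ j
  mono : ∀ i j, 1 ≤ i → i ≤ j → μ i ≤ μ j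

/-- `f` is `(μ^{|n}, M₀)`-smooth on `K`: `M₀ > 0`, `f` is of class `C^n` in an open neighbourhood
of `K`, and `‖f‖_{j,K} ≤ M₀ μ_1 ⋯ μ_j` for `0 ≤ j ≤ n`. -/
structure IsSmooth {d : ℕ} (μ : ℕ → ℝ) (n : ℕ) (M₀ : ℝ) (K : Set (EuclideanSpace ℝ (Fin d)))
    (f : EuclideanSpace ℝ (Fin d) → ℝ) : Prop where
  pos : 0 < M₀
  contDiff : ∃ U : Set (EuclideanSpace ℝ (Fin d)), IsOpen U ∧ K ⊆ U ∧ ContDiffOn ℝ (n : ℕ∞) f U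
  bound : ∀ j, j ≤ n → derivNorm j K f ≤ M₀ * ∏ i ∈ Finset.Icc 1 j, μ i

/-- `Σ_μ(m,n) = ∑_{j=m}^n 1/μ_j`. -/
def sigma (μ : ℕ → ℝ) (m n : ℕ) : ℝ := ∑ j ∈ Finset.Icc m n, 1 / μ j

/-- `Σ_μ(m,∞) = ∑_{j=m}^∞ 1/μ_j`, with values in `[0,∞]`. -/
def sigmaTop (μ : ℕ → ℝ) (m : ℕ) : ENNReal := ∑' j : ℕ, ENNReal.ofReal (1 / μ (m + j))

/-- `j₀(b)`, the smallest natural number `≥ log b⁻¹`. -/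
def jZero (b : ℝ) : ℕ := ⌈Real.log b⁻¹⌉₊

/-- The `μ`-degree at `b`: `sup {n ∈ ℕ : Σ_μ(j₀(b)+1, n) < e}`, an element of `ℕ ∪ {∞}`. -/
def degree (μ : ℕ → ℝ) (b : ℝ) : ℕ∞ :=
  sSup ((fun n : ℕ => (n : ℕ∞)) '' {n : ℕ | sigma μ (jZero b + 1) n < Real.exp 1})

/-- `(μ, K)` is admissible data: `Σ_μ(1,∞) > diam(K) e`. -/
structure IsAdmissibleData {d : ℕ} (μ : ℕ → ℝ) (K : Set (EuclideanSpace ℝ (Fin d))) : Prop where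
  weight : IsAdmissibleWeight μ
  body : IsConvexBody K
  lt_sigma : ENNReal.ofReal (Metric.diam K * Real.exp 1) < sigmaTop μ 1

/-- The integer associated with admissible data `(μ, K)`: the `diam(K) μ`-degree at `1`, plus one
(it is finite for admissible data). -/
def associatedInteger {d : ℕ} (μ : ℕ → ℝ) (K : Set (EuclideanSpace ℝ (Fin d))) : ℕ∞ :=
  degree (fun j => Metric.diam K * μ j) 1 + 1

/-- `m : [1,∞) → (0,∞)` is an increasing, continuous, piecewise `C¹` function with `m(k) = μ_k`
for all integers `k ≥ 1`. -/
structure IsInterpolant (m : ℝ → ℝ) (μ : ℕ → ℝ) : Prop where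
  pos : ∀ s, 1 ≤ s → 0 < m s
  mono : MonotoneOn m (Ici 1)
  cont : ContinuousOn m (Ici 1)
  piecewise : ∃ a : ℕ → ℝ, a 0 = 1 ∧ StrictMono a ∧ Filter.Tendsto a Filter.atTop Filter.atTop ∧
    ∀ k, ContDiffOn ℝ 1 m (Icc (a k) (a (k + 1)))
  interp : ∀ k : ℕ, 1 ≤ k → m k = μ k

/-- The derivative of `m : [1,∞) → ℝ` at `s`: the left derivative, which is the derivative wherever
`m` is differentiable, and the (necessarily right) derivative at the end point `s = 1`. -/
def oneSidedDeriv (m : ℝ → ℝ) (s : ℝ) : ℝ :=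
  if s = 1 then derivWithin m (Ici 1) 1 else derivWithin m (Iic s) s

/-- `γ_m(n) = sup_{1 ≤ s ≤ n} s m'(s) / m(s)`. -/
def gam (m : ℝ → ℝ) (n : ℕ) : ℝ :=
  sSup ((fun s : ℝ => s * oneSidedDeriv m s / m s) '' Icc 1 (n : ℝ))

/-- `Γ_m(n) = 4 e^{4 + γ_m(n)}`. -/
def Gam (m : ℝ → ℝ) (n : ℕ) : ℝ := 4 * Real.exp (4 + gam m n)

end Remez

end

/-! Let `x₀` be a maximum point of `|f|` on `K`. In polar coordinates around `x₀` it is enough to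
bound the sublevel set on every segment of `K` issuing from `x₀`. The radial weight `r ^ (d - 1)` is
at most `l ^ (d - 1)` on a segment of length `l`, whereas its integral over the segment is `l ^ d /
d`; this costs the factor `d` (`volume_le_of_rays`).

On a segment of length `l`, the directional derivatives of `f`, divided by the maximum, form a chain
`G j` with `|G j| ≤ μ 1 ⋯ μ j`, and `|G 0| = 1` at the end `x₀`. Suppose that the sublevel set has
measure `v > 4 e⁴ l t ^ (1 / n)`. It contains `n + 1` points with gaps at least `v / (n + 1)`, and
the polynomial `P` of degree at most `n` interpolating `G 0` there has small derivatives. By Rolle,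
`G j - P⁽ʲ⁾` vanishes at some `y j`, with `y 0 > y 1 > ⋯ > y n`, so every `G j` is small at `y j`
(`volume_sublevel_chain_le`).

Bang's theorem (`chain_lt_one`) then gives a contradiction. Starting at `y n`, the whole chain stays
below a barrier that needs time `1 / (e μ j)` to rise from `e⁻ʲ` to `e⁻⁽ʲ⁻¹⁾`. When `e l ≤ ∑ 1 / μ
j`, the sum running up to `n + 1`, the barrier has not reached the level `1` at `x₀`.

The definition of `N` supplies this sum condition with `n = N - 1`, since `l ≤ diam K`. Shorter
segments use a smaller `n`, which only improves the exponent. The argument yields the constant `4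
e⁴`, and `Gam` is at least that. -/

namespace Remez

/-! ### Bang's theorem for chains of functions. -/

/-- Grönwall estimate for a chain `W j' = ν (j + 1) W (j + 1)` whose `k`-th member is small. -/
theorem chain_gronwall {W : ℕ → ℝ → ℝ} {ν : ℕ → ℝ} {p : ℕ} {l : ℝ}
    (hν : ∀ j, 1 ≤ j → 0 < ν j) (hmono : ∀ i j, 1 ≤ i → i ≤ j → ν i ≤ ν j)
    (hW : ∀ j < p, ∀ s ∈ Icc 0 l, HasDerivAt (W j) (ν (j + 1) * W (j + 1) s) s)
    (hb : ∀ j ≤ p, ∀ s ∈ Icc 0 l, |W j s| ≤ Real.exp (-(j : ℝ)))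
    {i k : ℕ} (hk : 1 ≤ k) (hkp : k ≤ p) {a b c : ℝ} (ha : 0 ≤ a) (hab : a ≤ b) (hbl : b ≤ l)
    (hc : Real.exp (-(k : ℝ)) ≤ c) (hi : ∀ j, i ≤ j → j ≤ p → |W j a| ≤ c) :
    ∀ j, i ≤ j → j ≤ p → |W j b| ≤ c * Real.exp (ν k * (b - a)) := by
  have hc0 : 0 ≤ c := (Real.exp_pos _).le.trans hc
  intro j hij hjp
  have hmul : c ≤ c * Real.exp (ν k * (b - a)) := by
    refine le_mul_of_one_le_right hc0 (Real.one_le_exp ?_)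
    exact mul_nonneg (hν k hk).le (by linarith)
  rcases le_or_gt k j with hkj | hjk
  · refine (hb j hjp b ⟨ha.trans hab, hbl⟩).trans (le_trans ?_ hmul)
    refine le_trans ?_ hc
    gcongr
  -- The constant last coordinate dominates `W k`, which closes the differential inequality. Indices
  -- below `i` are set to zero because nothing is known about them at `a`.
  set v : ℝ → (Fin k → ℝ) × ℝ :=
    fun s => (fun q => if i ≤ (q : ℕ) then W q s else 0, Real.exp (-(k : ℝ))) with hv
  set v' : ℝ → (Fin k → ℝ) × ℝ :=
    fun s => (fun q => if i ≤ (q : ℕ) then ν (q + 1) * W (q + 1) s else 0, 0) with hv'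
  have hder : ∀ s ∈ Icc a b, HasDerivAt v (v' s) s := by
    intro s hs
    refine HasDerivAt.prodMk (hasDerivAt_pi.2 fun q => ?_) (hasDerivAt_const _ _)
    by_cases hq : i ≤ (q : ℕ)
    · simpa [hq] using hW q (q.2.trans_le hkp) s ⟨ha.trans hs.1, hs.2.trans hbl⟩
    · simpa [hq] using hasDerivAt_const s (0 : ℝ)
  have hbound : ∀ s ∈ Ico a b, ‖v' s‖ ≤ ν k * ‖v s‖ + 0 := by
    intro s hs
    have hnn : 0 ≤ ν k * ‖v s‖ := mul_nonneg (hν k hk).le (norm_nonneg _)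
    have hs' : s ∈ Icc 0 l := ⟨ha.trans hs.1, hs.2.le.trans hbl⟩
    rw [add_zero, Prod.norm_def]
    refine max_le ((pi_norm_le_iff_of_nonneg hnn).2 fun q => ?_) (by simp [hv', hnn])
    by_cases hq : i ≤ (q : ℕ)
    · simp only [hv', hq, if_true, norm_mul, Real.norm_eq_abs]
      rw [abs_of_pos (hν _ (by omega))]
      refine mul_le_mul (hmono _ _ (by omega) (by omega)) ?_ (abs_nonneg _) (hν k hk).le
      rcases Nat.lt_or_ge (q + 1) k with h | h
      · have h1 : ‖(v s).1 ⟨q + 1, h⟩‖ ≤ ‖v s‖ := (norm_le_pi_norm _ _).trans (norm_fst_le _)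
        have h2 : i ≤ (q : ℕ) + 1 := by omega
        simpa [hv, h2] using h1
      · have h1 : (q : ℕ) + 1 = k := by omega
        rw [h1]
        refine (hb k hkp s hs').trans ?_
        exact le_trans (le_abs_self _) (norm_snd_le (v s))
    · simpa [hv', hq] using hnn
  have hstart : ‖v a‖ ≤ c := by
    rw [Prod.norm_def]
    refine max_le ((pi_norm_le_iff_of_nonneg hc0).2 fun q => ?_) (by simpa [hv] using hc)
    by_cases hq : i ≤ (q : ℕ)
    · simpa [hv, hq] using hi q hq (q.2.le.trans hkp)
    · simpa [hv, hq] using hc0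
  have key := norm_le_gronwallBound_of_norm_deriv_right_le
    (fun s hs => (hder s hs).continuousAt.continuousWithinAt)
    (fun s hs => (hder s ⟨hs.1, hs.2.le⟩).hasDerivWithinAt) hstart hbound b ⟨hab, le_rfl⟩
  rw [gronwallBound_ε0] at key
  have h1 : ‖(v b).1 ⟨j, hjk⟩‖ ≤ ‖v b‖ := (norm_le_pi_norm _ _).trans (norm_fst_le _)
  simp only [hv, hij, if_true, Real.norm_eq_abs] at h1
  exact h1.trans key

/-- The time at which the Bang barrier started at time `a` reaches the level `exp (-k)`. -/
noncomputable def barrierTime (ν : ℕ → ℝ) (p : ℕ) (a : ℝ) (k : ℕ) : ℝ :=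
  a + ∑ j ∈ Finset.Icc (k + 1) p, 1 / ν j

/-- The `k`-th exponential arc of the Bang barrier. -/
noncomputable def barrier (ν : ℕ → ℝ) (p : ℕ) (a : ℝ) (k : ℕ) (s : ℝ) : ℝ :=
  Real.exp (-(k : ℝ) + ν k * (s - barrierTime ν p a k))

theorem barrierTime_succ (ν : ℕ → ℝ) {p : ℕ} (a : ℝ) {k : ℕ} (hk : k < p) :
    barrierTime ν p a k = barrierTime ν p a (k + 1) + 1 / ν (k + 1) := by
  unfold barrierTime
  rw [← Finset.insert_Icc_add_one_left_eq_Icc (show k + 1 ≤ p from hk), Finset.sum_insert (by simp)]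
  ring

/-- Going back from `barrierTime ν p a k` to `a`, the exponent of the `k`-th arc drops by at most
`1` for each of the `p - k` intervals of length `1 / ν j`, since `ν k ≤ ν j`. -/
theorem exp_le_barrier {ν : ℕ → ℝ} {p : ℕ} {a : ℝ}
    (hν : ∀ j, 1 ≤ j → 0 < ν j) (hmono : ∀ i j, 1 ≤ i → i ≤ j → ν i ≤ ν j)
    {k : ℕ} (hk : 1 ≤ k) (hkp : k ≤ p) {s : ℝ} (hs : a ≤ s) :
    Real.exp (-(p : ℝ)) ≤ barrier ν p a k s := by
  unfold barrier barrierTime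
  gcongr
  have h1 : ν k * ∑ j ∈ Finset.Icc (k + 1) p, 1 / ν j ≤ (p : ℝ) - k := by
    rw [Finset.mul_sum]
    calc ∑ j ∈ Finset.Icc (k + 1) p, ν k * (1 / ν j)
        ≤ ∑ j ∈ Finset.Icc (k + 1) p, (1 : ℝ) := by
          refine Finset.sum_le_sum fun j hj => ?_
          rw [Finset.mem_Icc] at hj
          rw [mul_one_div, div_le_one (hν j (by omega))]
          exact hmono k j hk (by omega)
      _ = (p : ℝ) - k := by simp [Nat.cast_sub hkp]
  have h2 : 0 ≤ ν k * (s - a) := mul_nonneg (hν k hk).le (by linarith)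
  nlinarith

/-- Arcs `k + 1` and `k` meet at `barrierTime ν p a k` at height `exp (-k)`, and arc `k + 1` is the
steeper one, hence the lower one to the left. The logarithm of the barrier is thus concave, and
lying below the barrier means lying below all the arcs. -/
theorem barrier_succ_le {ν : ℕ → ℝ} {p : ℕ} {a : ℝ}
    (hν : ∀ j, 1 ≤ j → 0 < ν j) (hmono : ∀ i j, 1 ≤ i → i ≤ j → ν i ≤ ν j)
    {k : ℕ} (hk : 1 ≤ k) (hkp : k < p) {s : ℝ} (hs : s ≤ barrierTime ν p a k) :
    barrier ν p a (k + 1) s ≤ barrier ν p a k s := by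
  unfold barrier
  refine Real.exp_le_exp.2 ?_
  have h1 := barrierTime_succ ν a hkp
  have h2 := hν (k + 1) (by omega)
  have h3 := hmono k (k + 1) hk (by omega)
  have h4 : ν (k + 1) * (barrierTime ν p a k - barrierTime ν p a (k + 1)) = 1 := by
    rw [h1]; field_simp; ring
  push_cast
  nlinarith [mul_nonneg (sub_nonneg.2 h3) (sub_nonneg.2 hs)]

/-- A chain which lies below the Bang barrier stays below it. -/
theorem chain_le_barrier {W : ℕ → ℝ → ℝ} {ν : ℕ → ℝ} {p : ℕ} {l a₀ : ℝ}
    (hν : ∀ j, 1 ≤ j → 0 < ν j) (hmono : ∀ i j, 1 ≤ i → i ≤ j → ν i ≤ ν j)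
    (hW : ∀ j < p, ∀ s ∈ Icc 0 l, HasDerivAt (W j) (ν (j + 1) * W (j + 1) s) s)
    (hb : ∀ j ≤ p, ∀ s ∈ Icc 0 l, |W j s| ≤ Real.exp (-(j : ℝ)))
    {i : ℕ} {a : ℝ} (ha₀ : 0 ≤ a₀) (ha : a₀ ≤ a)
    (hi : ∀ k, 1 ≤ k → k ≤ p → ∀ j, i ≤ j → j ≤ p → |W j a| ≤ barrier ν p a₀ k a)
    {k : ℕ} (hk : 1 ≤ k) (hkp : k ≤ p) :
    ∀ b, a ≤ b → b ≤ l → ∀ j, i ≤ j → j ≤ p → |W j b| ≤ barrier ν p a₀ k b := by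
  induction hkp using Nat.decreasingInduction with
  | self =>
    intro b hab hbl j hij hjp
    have h := chain_gronwall hν hmono hW hb hk le_rfl (ha₀.trans ha) hab hbl
      (exp_le_barrier hν hmono hk le_rfl ha) (hi p hk le_rfl) j hij hjp
    refine h.trans_eq ?_
    unfold barrier
    rw [← Real.exp_add]
    ring_nf
  | of_succ k hkp ih =>
    have ih := ih (by omega)
    have step : ∀ a', a ≤ a' → barrierTime ν p a₀ k ≤ a' →
        (∀ j, i ≤ j → j ≤ p → |W j a'| ≤ barrier ν p a₀ k a') →
        ∀ b, a' ≤ b → b ≤ l → ∀ j, i ≤ j → j ≤ p → |W j b| ≤ barrier ν p a₀ k b := by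
      intro a' ha' hτ hstart b hab hbl j hij hjp
      have h := chain_gronwall hν hmono hW hb hk hkp.le ((ha₀.trans ha).trans ha') hab hbl
        (c := barrier ν p a₀ k a') (by
          unfold barrier
          gcongr
          have := mul_nonneg (hν k hk).le (sub_nonneg.2 hτ)
          linarith) hstart j hij hjp
      refine h.trans_eq ?_
      unfold barrier
      rw [← Real.exp_add]
      ring_nf
    intro b hab hbl
    -- Before the meeting time arc `k + 1` is the lower one, so the induction hypothesis suffices.
    -- After it, Grönwall with rate `ν k` restarts from the later of `a` and the meeting time, where
    -- arc `k` has height at least `exp (-k)`.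
    rcases le_total b (barrierTime ν p a₀ k) with h | h
    · exact fun j hij hjp => (ih b hab hbl j hij hjp).trans (barrier_succ_le hν hmono hk hkp h)
    rcases le_total a (barrierTime ν p a₀ k) with h' | h'
    · exact step _ h' le_rfl (fun j hij hjp => (ih _ h' (h.trans hbl) j hij hjp).trans
        (barrier_succ_le hν hmono hk hkp le_rfl)) b h hbl
    · exact step a le_rfl h' (hi k hk hkp.le) b hab hbl

/-- Bang's theorem for chains: if every `W j` is small at some point `y j` and these points are
ordered backwards, then `W 0` cannot be large at the end of a short interval. -/
theorem chain_lt_one {W : ℕ → ℝ → ℝ} {ν : ℕ → ℝ} {p : ℕ} {l : ℝ}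
    (hν : ∀ j, 1 ≤ j → 0 < ν j) (hmono : ∀ i j, 1 ≤ i → i ≤ j → ν i ≤ ν j)
    (hW : ∀ j < p, ∀ s ∈ Icc 0 l, HasDerivAt (W j) (ν (j + 1) * W (j + 1) s) s)
    (hb : ∀ j ≤ p, ∀ s ∈ Icc 0 l, |W j s| ≤ Real.exp (-(j : ℝ)))
    (hp : 1 ≤ p) {y : ℕ → ℝ} (hy₀ : y 0 ≤ l) (hy : ∀ j, j + 1 < p → y (j + 1) ≤ y j)
    (hpos : 0 < y (p - 1)) (hsmall : ∀ j < p, |W j (y j)| ≤ Real.exp (-(p : ℝ)))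
    (hl : l ≤ ∑ j ∈ Finset.Icc 1 p, 1 / ν j) : |W 0 l| < 1 := by
  have hy1 : ∀ j < p, y (p - 1) ≤ y j ∧ y j ≤ l := by
    have h1 : ∀ j < p, y j ≤ l := by
      intro j hj
      induction j with
      | zero => exact hy₀
      | succ j ih => exact (hy j hj).trans (ih (by omega))
    have h2 : ∀ q j, j + q = p - 1 → y (p - 1) ≤ y j := by
      intro q
      induction q with
      | zero => intro j hj; rw [← hj]; simp
      | succ q ih => intro j hj; exact (ih (j + 1) (by omega)).trans (hy j (by omega))
    exact fun j hj => ⟨h2 (p - 1 - j) j (by omega), h1 j hj⟩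
  -- Moving right from `y (p - 1)` to `y 0`, the point `y i` admits one more member: those with `j >
  -- i` are carried along by the barrier, and `W i` starts afresh below `exp (-p)`, hence below
  -- every arc.
  have main : ∀ q i, i + q + 1 = p → ∀ k, 1 ≤ k → k ≤ p → ∀ j, i ≤ j → j ≤ p →
      |W j (y i)| ≤ barrier ν p (y (p - 1)) k (y i) := by
    intro q
    induction q with
    | zero =>
      intro i hi k hk hkp j hij hjp
      have hi' : i = p - 1 := by omega
      refine le_trans ?_ (exp_le_barrier hν hmono hk hkp (hy1 i (by omega)).1)
      rcases Nat.lt_or_ge j p with h | h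
      · obtain rfl : j = i := by omega
        exact hsmall j h
      · obtain rfl : j = p := by omega
        exact hb j le_rfl _ ⟨hpos.le.trans (hy1 i (by omega)).1, (hy1 i (by omega)).2⟩
    | succ q ih =>
      intro i hi k hk hkp j hij hjp
      rcases Nat.lt_or_ge i j with h | h
      · exact chain_le_barrier hν hmono hW hb hpos.le (hy1 (i + 1) (by omega)).1
          (ih (i + 1) (by omega)) hk hkp (y i) (hy i (by omega)) (hy1 i (by omega)).2 j h hjp
      · obtain rfl : j = i := by omega
        exact (hsmall j (by omega)).trans
          (exp_le_barrier hν hmono hk hkp (hy1 j (by omega)).1)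
  have h := chain_le_barrier hν hmono hW hb hpos.le (hy1 0 (by omega)).1
    (main (p - 1) 0 (by omega)) le_rfl hp l hy₀ le_rfl 0 le_rfl (by omega)
  refine h.trans_lt ?_
  unfold barrier
  rw [Real.exp_lt_one_iff]
  have h1 := barrierTime_succ ν (y (p - 1)) (show 0 < p by omega)
  have h0 : barrierTime ν p (y (p - 1)) 0 = y (p - 1) + ∑ j ∈ Finset.Icc 1 p, 1 / ν j := rfl
  have h2 := hν 1 le_rfl
  -- The strict inequality comes from `0 < y (p - 1)`: the barrier starts late and has not yet
  -- reached height `1` at `l`.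
  have h3 : l - barrierTime ν p (y (p - 1)) 1 < 1 / ν 1 := by
    simp only [zero_add] at h1
    linarith
  rw [lt_div_iff₀ h2] at h3
  push_cast
  linarith


/-! ### Rolle's theorem along a chain. -/

/-- Iterated Rolle theorem for chains, keeping track of the last zeros. -/
theorem exists_last_zeros (n : ℕ) {l : ℝ} : ∀ {H : ℕ → ℝ → ℝ} {z : ℕ → ℝ},
    (∀ j < n, ∀ s ∈ Icc 0 l, HasDerivAt (H j) (H (j + 1) s) s) →
    (∀ i < n, z i < z (i + 1)) → (∀ i ≤ n, z i ∈ Icc 0 l) → (∀ i ≤ n, H 0 (z i) = 0) →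
    ∃ y : ℕ → ℝ, y 0 = z n ∧ (∀ j < n, y (j + 1) < y j) ∧
      (∀ j ≤ n, z 0 ≤ y j ∧ H j (y j) = 0) ∧ (1 ≤ n → z 0 < y n) := by
  induction n with
  | zero =>
    intro H z _ _ _ h0
    refine ⟨fun _ => z 0, rfl, by simp, fun j hj => ⟨le_rfl, ?_⟩, by simp⟩
    obtain rfl : j = 0 := by omega
    exact h0 0 le_rfl
  | succ n ih =>
    intro H z hH hz hzl h0
    have hrolle : ∀ i, ∃ c, i ≤ n → c ∈ Ioo (z i) (z (i + 1)) ∧ H 1 c = 0 := by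
      intro i
      by_cases hi : i ≤ n
      · have hsub : ∀ s ∈ Icc (z i) (z (i + 1)), s ∈ Icc 0 l := fun s hs =>
          ⟨(hzl i (by omega)).1.trans hs.1, hs.2.trans (hzl (i + 1) (by omega)).2⟩
        obtain ⟨c, hc, hc'⟩ := exists_hasDerivAt_eq_zero (hz i (by omega))
          (fun s hs => (hH 0 (by omega) s (hsub s hs)).continuousAt.continuousWithinAt)
          ((h0 i (by omega)).trans (h0 (i + 1) (by omega)).symm)
          (fun s hs => hH 0 (by omega) s (hsub s (Ioo_subset_Icc_self hs)))
        exact ⟨c, fun _ => ⟨hc, hc'⟩⟩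
      · exact ⟨0, fun h => absurd h hi⟩
    choose z' hz' using hrolle
    obtain ⟨y, hy0, hy1, hy2, -⟩ := ih (H := fun j => H (j + 1)) (z := z')
      (fun j hj => hH (j + 1) (by omega))
      (fun i hi => (hz' i (by omega)).1.2.trans (hz' (i + 1) (by omega)).1.1)
      (fun i hi => ⟨(hzl i (by omega)).1.trans (hz' i hi).1.1.le,
        (hz' i hi).1.2.le.trans (hzl (i + 1) (by omega)).2⟩)
      (fun i hi => (hz' i hi).2)
    have hlt : z 0 < z' 0 := (hz' 0 (by omega)).1.1
    have hz0 : ∀ i ≤ n + 1, z 0 ≤ z i := by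
      intro i hi
      induction i with
      | zero => exact le_rfl
      | succ i ihi => exact (ihi (by omega)).trans (hz i (by omega)).le
    refine ⟨fun j => if j = 0 then z (n + 1) else y (j - 1), by simp, ?_, ?_, ?_⟩
    · intro j hj
      rcases j with _ | j
      · simpa [hy0] using (hz' n le_rfl).1.2
      · simpa using hy1 j (by omega)
    · intro j hj
      rcases j with _ | j
      · exact ⟨by simpa using hz0 (n + 1) le_rfl, by simpa using h0 (n + 1) le_rfl⟩
      · exact ⟨by simpa using hlt.le.trans (hy2 j (by omega)).1,
          by simpa using (hy2 j (by omega)).2⟩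
    · intro _
      simpa using hlt.trans_le (hy2 n le_rfl).1

/-! ### Spaced nodes and polynomial interpolation. -/

/-- A closed set of measure larger than `n * h` contains `n + 1` points with gaps at least `h`. -/
theorem exists_spaced_points {E : Set ℝ} {l h : ℝ} {n : ℕ} (hE : IsClosed E) (hEl : E ⊆ Icc 0 l)
    (hh : 0 < h) (hvol : ENNReal.ofReal (n * h) < volume E) :
    ∃ x : ℕ → ℝ, (∀ i ≤ n, x i ∈ E) ∧ ∀ i < n, x i + h ≤ x (i + 1) := by
  have hinf : ∀ F : Set ℝ, IsClosed F → F ⊆ E → F.Nonempty → sInf F ∈ F :=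
    fun F hF hFE hne => hF.csInf_mem hne ⟨0, fun s hs => (hEl (hFE hs)).1⟩
  -- Greedy choice: each node is the first point of `E` at distance at least `h` to the right of the
  -- previous one. The part of `E` left of `x k` then has measure at most `k * h`.
  let x : ℕ → ℝ := fun k => Nat.rec (sInf E) (fun _ y => sInf (E ∩ Ici (y + h))) k
  have hx : ∀ k, x (k + 1) = sInf (E ∩ Ici (x k + h)) := fun k => rfl
  have hcover : ∀ k s, volume (E ∩ Iio (x k)) ≤ ENNReal.ofReal (k * h) →
      E ∩ Ici (x k + h) ⊆ Ici s → volume (E ∩ Iio s) ≤ ENNReal.ofReal ((k + 1 : ℕ) * h) := by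
    intro k s hk hs
    have hsub : E ∩ Iio s ⊆ (E ∩ Iio (x k)) ∪ Ico (x k) (x k + h) := by
      intro r hr
      rcases lt_or_ge r (x k) with h1 | h1
      · exact Or.inl ⟨hr.1, h1⟩
      · refine Or.inr ⟨h1, lt_of_not_ge fun h2 => ?_⟩
        exact absurd (mem_Ici.1 (hs ⟨hr.1, h2⟩)) (not_le.2 hr.2)
    refine (measure_mono hsub).trans ((measure_union_le _ _).trans ?_)
    rw [Real.volume_Ico]
    refine (add_le_add hk le_rfl).trans ?_
    rw [← ENNReal.ofReal_add (by positivity) (by linarith)]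
    refine ENNReal.ofReal_le_ofReal ?_
    push_cast
    linarith
  have hne : ∀ k < n, volume (E ∩ Iio (x k)) ≤ ENNReal.ofReal (k * h) →
      (E ∩ Ici (x k + h)).Nonempty := by
    intro k hk hvk
    by_contra hcon
    rw [not_nonempty_iff_eq_empty] at hcon
    -- If no further node existed, all of `E` would have measure at most `(k + 1) * h ≤ n * h`. Any
    -- bound beyond `l` serves as `s`.
    have h1 := hcover k (l + 1) hvk (by simp [hcon])
    have h2 : E ∩ Iio (l + 1) = E :=
      inter_eq_left.2 fun s hs => lt_of_le_of_lt (hEl hs).2 (lt_add_one l)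
    rw [h2] at h1
    refine absurd (hvol.trans_le h1) (not_lt.2 (ENNReal.ofReal_le_ofReal ?_))
    have : ((k + 1 : ℕ) : ℝ) ≤ n := by exact_mod_cast hk
    gcongr
  have main : ∀ k ≤ n, x k ∈ E ∧ volume (E ∩ Iio (x k)) ≤ ENNReal.ofReal (k * h) := by
    intro k
    induction k with
    | zero =>
      intro _
      have hEne : E.Nonempty := by
        rw [nonempty_iff_ne_empty]
        rintro rfl
        simp at hvol
      refine ⟨hinf E hE subset_rfl hEne, ?_⟩
      have : E ∩ Iio (x 0) = ∅ := by
        rw [eq_empty_iff_forall_notMem]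
        rintro s ⟨hs, hs'⟩
        exact absurd (csInf_le ⟨0, fun s hs => (hEl hs).1⟩ hs) (not_le.2 hs')
      simp [this]
    | succ k ih =>
      intro hk
      obtain ⟨-, h2⟩ := ih (by omega)
      have h3 := hinf (E ∩ Ici (x k + h)) (hE.inter isClosed_Ici) inter_subset_left
        (hne k (by omega) h2)
      refine ⟨h3.1, hcover k _ h2 fun s hs => ?_⟩
      exact csInf_le ⟨0, fun s hs => (hEl hs.1).1⟩ hs
  refine ⟨x, fun i hi => (main i hi).1, fun i hi => ?_⟩
  exact (hinf (E ∩ Ici (x i + h)) (hE.inter isClosed_Ici) inter_subset_left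
    (hne i hi (main i hi.le).2)).2

theorem mul_le_sub_of_spaced {x : ℕ → ℝ} {n : ℕ} {h : ℝ} (hx : ∀ i < n, x i + h ≤ x (i + 1))
    {i j : ℕ} (hij : i ≤ j) (hj : j ≤ n) : ((j : ℝ) - i) * h ≤ x j - x i := by
  induction j, hij using Nat.le_induction with
  | base => simp
  | succ j hij ih =>
    have := ih (by omega)
    have := hx j (by omega)
    push_cast
    linarith

/-- Since `|x k - x i| ≥ |k - i| * h`, the nodes to the left of `x k` contribute `k!` and those to
the right `(n - k)!`. -/
theorem factorial_mul_le_prod_dist {x : ℕ → ℝ} {h : ℝ} (hh : 0 < h) (n : ℕ)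
    (hx : ∀ i < n, x i + h ≤ x (i + 1)) {k : ℕ} (hk : k ≤ n) :
    h ^ n * (k.factorial * (n - k).factorial) ≤
      ∏ i ∈ (Finset.range (n + 1)).erase k, |x k - x i| := by
  induction n generalizing k with
  | zero =>
    obtain rfl : k = 0 := by omega
    simp
  | succ n ih =>
    rcases Nat.lt_or_ge n k with h1 | h1
    · obtain rfl : k = n + 1 := by omega
      have he : (Finset.range (n + 1 + 1)).erase (n + 1) = Finset.range (n + 1) := by
        rw [Finset.range_add_one, Finset.erase_insert (by simp)]
      rw [he, ← Finset.prod_range_reflect]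
      calc h ^ (n + 1) * (((n + 1).factorial : ℝ) * ((n + 1 - (n + 1)).factorial : ℝ))
          = ∏ i ∈ Finset.range (n + 1), (h * ((i + 1 : ℕ) : ℝ)) := by
            rw [Finset.prod_mul_distrib, ← Nat.cast_prod, Finset.prod_range_add_one_eq_factorial]
            simp
        _ ≤ _ := by
            refine Finset.prod_le_prod (fun i _ => by positivity) fun i hi => ?_
            rw [Finset.mem_range] at hi
            have h2 := mul_le_sub_of_spaced hx (show n + 1 - 1 - i ≤ n + 1 by omega) le_rfl
            refine le_trans (le_of_eq ?_) (h2.trans (le_abs_self _))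
            rw [show n + 1 - 1 - i = n - i by omega, Nat.cast_sub (by omega)]
            push_cast
            ring
    · have he : (Finset.range (n + 1 + 1)).erase k =
          insert (n + 1) ((Finset.range (n + 1)).erase k) := by
        rw [Finset.range_add_one, Finset.erase_insert_of_ne (by omega)]
      rw [he, Finset.prod_insert (by simp), show n + 1 - k = n - k + 1 by omega, Nat.factorial_succ]
      have h2 := mul_le_sub_of_spaced hx (show k ≤ n + 1 by omega) le_rfl
      have h3 : h * ((n - k + 1 : ℕ) : ℝ) ≤ |x k - x (n + 1)| := by
        rw [abs_sub_comm]
        refine le_trans (le_of_eq ?_) (h2.trans (le_abs_self _))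
        rw [Nat.cast_add, Nat.cast_sub h1]
        push_cast
        ring
      calc h ^ (n + 1) * ((k.factorial : ℝ) * (((n - k + 1) * (n - k).factorial : ℕ) : ℝ))
          = (h * ((n - k + 1 : ℕ) : ℝ)) * (h ^ n * (k.factorial * (n - k).factorial)) := by
            push_cast
            ring
        _ ≤ _ := mul_le_mul h3 (ih (fun i hi => hx i (by omega)) h1) (by positivity) (abs_nonneg _)

/-- The `j`-th derivative is `j!` times the sum of all products of `S.card - j` of the factors, each
factor being at most `l` in absolute value. -/
theorem abs_eval_iterate_derivative_prod_le {S : Finset ℝ} {l y : ℝ} (hS : ∀ a ∈ S, a ∈ Icc 0 l)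
    (hy : y ∈ Icc 0 l) {j : ℕ} (hj : j ≤ S.card) :
    |(Polynomial.derivative^[j] (∏ a ∈ S, (Polynomial.X - Polynomial.C a))).eval y| ≤
      S.card.descFactorial j * l ^ (S.card - j) := by
  rw [Polynomial.iterate_derivative_prod_X_sub_C hj]
  simp only [Polynomial.eval_mul, Polynomial.eval_natCast, Polynomial.eval_finsetSum,
    Polynomial.eval_prod, Polynomial.eval_sub, Polynomial.eval_X, Polynomial.eval_C, abs_mul,
    Nat.abs_cast]
  have hle : |∑ T ∈ S.powersetCard (S.card - j), ∏ a ∈ T, (y - a)| ≤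
      S.card.choose j * l ^ (S.card - j) := by
    refine (Finset.abs_sum_le_sum_abs _ _).trans ?_
    rw [← Nat.choose_symm hj, ← Finset.card_powersetCard, ← nsmul_eq_mul]
    refine Finset.sum_le_card_nsmul _ _ _ fun T hT => ?_
    rw [Finset.mem_powersetCard] at hT
    rw [Finset.abs_prod, ← hT.2, ← Finset.prod_const]
    refine Finset.prod_le_prod (fun _ _ => abs_nonneg _) fun a ha => ?_
    have := hS a (hT.1 ha)
    rw [abs_le]
    constructor <;> linarith [hy.1, hy.2, this.1, this.2]
  rw [Nat.descFactorial_eq_factorial_mul_choose]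
  push_cast
  rw [mul_assoc]
  gcongr

/-- A polynomial that interpolates small values at well spaced nodes has small derivatives. -/
theorem exists_interpolating_polynomial {x : ℕ → ℝ} {l h t : ℝ} {n : ℕ} (hh : 0 < h)
    (hx : ∀ i < n, x i + h ≤ x (i + 1)) (hxl : ∀ i ≤ n, x i ∈ Icc 0 l) {g : ℝ → ℝ}
    (hg : ∀ i ≤ n, |g (x i)| ≤ t) :
    ∃ P : Polynomial ℝ, (∀ i ≤ n, P.eval (x i) = g (x i)) ∧ ∀ j ≤ n, ∀ y ∈ Icc 0 l,
      |(Polynomial.derivative^[j] P).eval y| ≤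
        t * 2 ^ n * l ^ (n - j) / ((n - j).factorial * h ^ n) := by
  have hinj : InjOn x (Finset.range (n + 1)) := by
    intro i hi j hj hij
    simp only [Finset.coe_range, mem_Iio] at hi hj
    by_contra hne
    rcases Nat.lt_or_gt_of_ne hne with h1 | h1
    · have h2 := mul_le_sub_of_spaced hx h1.le (by omega)
      have h3 : (i : ℝ) < j := by exact_mod_cast h1
      have := mul_pos (sub_pos.2 h3) hh
      linarith
    · have h2 := mul_le_sub_of_spaced hx h1.le (by omega)
      have h3 : (j : ℝ) < i := by exact_mod_cast h1
      have := mul_pos (sub_pos.2 h3) hh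
      linarith
  refine ⟨Lagrange.interpolate (Finset.range (n + 1)) x fun i => g (x i), fun i hi =>
    Lagrange.eval_interpolate_at_node _ hinj (Finset.mem_range.2 (by omega)), fun j hj y hy => ?_⟩
  have hl : 0 ≤ l := hy.1.trans hy.2
  have hbasis : ∀ k ∈ Finset.range (n + 1),
      |(Polynomial.derivative^[j]
        (Polynomial.C (g (x k)) * Lagrange.basis (Finset.range (n + 1)) x k)).eval y| ≤
      t / (h ^ n * (k.factorial * (n - k).factorial)) * (n.descFactorial j * l ^ (n - j)) := by
    intro k hk
    have hkn : k ≤ n := Nat.lt_succ_iff.1 (Finset.mem_range.1 hk)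
    have hinj' : InjOn x ((Finset.range (n + 1)).erase k) :=
      hinj.mono (by simp)
    have hcard : (((Finset.range (n + 1)).erase k).image x).card = n := by
      rw [Finset.card_image_of_injOn hinj', Finset.card_erase_of_mem hk]
      simp
    have hprod : Lagrange.basis (Finset.range (n + 1)) x k =
        Polynomial.C (∏ i ∈ (Finset.range (n + 1)).erase k, (x k - x i))⁻¹ *
          ∏ a ∈ ((Finset.range (n + 1)).erase k).image x, (Polynomial.X - Polynomial.C a) := by
      rw [Finset.prod_image hinj', ← Finset.prod_inv_distrib, map_prod, ← Finset.prod_mul_distrib]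
      rfl
    have hS := abs_eval_iterate_derivative_prod_le
      (S := ((Finset.range (n + 1)).erase k).image x) (l := l) (j := j) (by
        intro a ha
        obtain ⟨i, hi, rfl⟩ := Finset.mem_image.1 ha
        have := Finset.mem_range.1 (Finset.mem_of_mem_erase hi)
        exact hxl i (by omega)) hy (by omega)
    rw [hcard] at hS
    rw [hprod, ← mul_assoc, ← Polynomial.C_mul, Polynomial.iterate_derivative_C_mul,
      Polynomial.eval_mul, Polynomial.eval_C, abs_mul]
    refine mul_le_mul ?_ hS (abs_nonneg _) ?_
    · rw [abs_mul, abs_inv, Finset.abs_prod, ← div_eq_mul_inv]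
      exact div_le_div₀ ((abs_nonneg _).trans (hg k hkn)) (hg k hkn) (by positivity)
        (factorial_mul_le_prod_dist hh n hx hkn)
    · have := (abs_nonneg _).trans (hg k hkn)
      positivity
  rw [Lagrange.interpolate_apply, Polynomial.iterate_derivative_sum, Polynomial.eval_finsetSum]
  refine (Finset.abs_sum_le_sum_abs _ _).trans ((Finset.sum_le_sum hbasis).trans (le_of_eq ?_))
  rw [← Finset.sum_mul]
  -- This is the binomial identity `∑ n! / (k! (n - k)!) = 2 ^ n`.
  have hsum : ∑ k ∈ Finset.range (n + 1), t / (h ^ n * ((k.factorial : ℝ) * (n - k).factorial)) =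
      t * 2 ^ n / (h ^ n * n.factorial) := by
    have h2 : (2 : ℝ) ^ n = ∑ k ∈ Finset.range (n + 1), (n.choose k : ℝ) := by
      rw [← Nat.cast_sum, Nat.sum_range_choose]
      simp
    rw [h2, Finset.mul_sum, Finset.sum_div]
    refine Finset.sum_congr rfl fun k hk => ?_
    have hkn : k ≤ n := Nat.lt_succ_iff.1 (Finset.mem_range.1 hk)
    rw [Nat.cast_choose ℝ hkn]
    have h3 : (n.factorial : ℝ) ≠ 0 := by positivity
    have h4 : (k.factorial : ℝ) ≠ 0 := by positivity
    have h5 : ((n - k).factorial : ℝ) ≠ 0 := by positivity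
    field_simp
  have hdesc : (n.descFactorial j : ℝ) * (n - j).factorial = n.factorial := by
    rw [mul_comm]
    exact_mod_cast Nat.factorial_mul_descFactorial hj
  rw [hsum, ← hdesc]
  have h3 : (n.descFactorial j : ℝ) ≠ 0 := by
    have := Nat.descFactorial_pos.2 hj
    positivity
  have h5 : ((n - j).factorial : ℝ) ≠ 0 := by positivity
  field_simp


/-! ### The one-dimensional Remez inequality. -/

/-- By monotonicity `i / μ i ≤ ∑ 1 / μ k ≤ e l`, so `i ≤ e μ i l`; these are multiplied over `i ≤
j`. This replaces the factorials of the interpolation bound by the weights of the chain. -/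
theorem factorial_le_prod_mul_pow {μ : ℕ → ℝ} {l : ℝ} {n : ℕ} (hμ : ∀ j, 1 ≤ j → 0 < μ j)
    (hmono : ∀ i j, 1 ≤ i → i ≤ j → μ i ≤ μ j)
    (hlow : ∑ j ∈ Finset.Icc 1 n, 1 / μ j ≤ Real.exp 1 * l) {j : ℕ} (hj : j ≤ n) :
    (j.factorial : ℝ) ≤ Real.exp j * (∏ i ∈ Finset.Icc 1 j, μ i) * l ^ j := by
  have h1 : ∀ i, 1 ≤ i → i ≤ n → (i : ℝ) ≤ Real.exp 1 * μ i * l := by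
    intro i hi hin
    have h2 : (i : ℝ) * (1 / μ i) ≤ ∑ k ∈ Finset.Icc 1 n, 1 / μ k := by
      calc (i : ℝ) * (1 / μ i) = ∑ k ∈ Finset.Icc 1 i, 1 / μ i := by simp
        _ ≤ ∑ k ∈ Finset.Icc 1 i, 1 / μ k := by
            refine Finset.sum_le_sum fun k hk => ?_
            rw [Finset.mem_Icc] at hk
            exact one_div_le_one_div_of_le (hμ k hk.1) (hmono k i hk.1 hk.2)
        _ ≤ ∑ k ∈ Finset.Icc 1 n, 1 / μ k := by
            refine Finset.sum_le_sum_of_subset_of_nonneg (Finset.Icc_subset_Icc_right hin) ?_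
            intro k hk _
            rw [Finset.mem_Icc] at hk
            exact (one_div_pos.2 (hμ k hk.1)).le
    have h3 := h2.trans hlow
    rw [mul_one_div, div_le_iff₀ (hμ i hi)] at h3
    linarith
  induction j with
  | zero => simp
  | succ j ih =>
    rw [Finset.prod_Icc_succ_top (by omega), Nat.factorial_succ, pow_succ, Nat.cast_succ,
      Real.exp_add]
    have h4 := h1 (j + 1) (by omega) hj
    push_cast at h4 ⊢
    calc ((j : ℝ) + 1) * j.factorial
        ≤ (Real.exp 1 * μ (j + 1) * l) *
          (Real.exp j * (∏ i ∈ Finset.Icc 1 j, μ i) * l ^ j) :=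
          mul_le_mul h4 (ih (by omega)) (by positivity) (le_trans (by positivity) h4)
      _ = _ := by ring

theorem factorial_le_two_pow_mul {n j : ℕ} (hj : j ≤ n) :
    (n.factorial : ℝ) ≤ 2 ^ n * (j.factorial * (n - j).factorial) := by
  rw [← Nat.choose_mul_factorial_mul_factorial hj]
  push_cast
  rw [mul_assoc]
  have h1 : (n.choose j : ℝ) ≤ 2 ^ n := by exact_mod_cast Nat.choose_le_two_pow n j
  gcongr

/-- Remez inequality for a chain on an interval of length comparable to the sum of the `1 / μ j`. -/
theorem volume_sublevel_chain_le {G : ℕ → ℝ → ℝ} {μ : ℕ → ℝ} {n : ℕ} {l t : ℝ}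
    (hμ : ∀ j, 1 ≤ j → 0 < μ j) (hmono : ∀ i j, 1 ≤ i → i ≤ j → μ i ≤ μ j) (hl : 0 < l)
    (hn : 1 ≤ n) (ht : 0 < t)
    (hG : ∀ j < n + 1, ∀ s ∈ Icc 0 l, HasDerivAt (G j) (G (j + 1) s) s)
    (hb : ∀ j ≤ n + 1, ∀ s ∈ Icc 0 l, |G j s| ≤ ∏ i ∈ Finset.Icc 1 j, μ i)
    (hone : |G 0 l| = 1) (hlow : ∑ j ∈ Finset.Icc 1 n, 1 / μ j ≤ Real.exp 1 * l)
    (hup : Real.exp 1 * l ≤ ∑ j ∈ Finset.Icc 1 (n + 1), 1 / μ j) :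
    volume {s | s ∈ Icc 0 l ∧ |G 0 s| ≤ t} ≤
      ENNReal.ofReal (4 * Real.exp 4 * l * t ^ (1 / (n : ℝ))) := by
  set E := {s | s ∈ Icc 0 l ∧ |G 0 s| ≤ t} with hE
  have hcont : ContinuousOn (G 0) (Icc 0 l) := fun s hs =>
    (hG 0 (by omega) s hs).continuousAt.continuousWithinAt
  have hEcl : IsClosed E := hcont.abs.preimage_isClosed_of_isClosed isClosed_Icc isClosed_Iic
  have hEl : E ⊆ Icc 0 l := fun s hs => hs.1
  have hEfin : volume E ≠ ⊤ := measure_ne_top_of_subset hEl (by simp)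
  by_contra! hcon
  obtain ⟨v, hv⟩ : ∃ v, v = (volume E).toReal := ⟨_, rfl⟩
  have hvE : volume E = ENNReal.ofReal v := by rw [hv, ENNReal.ofReal_toReal hEfin]
  have hB : 0 < 4 * Real.exp 4 * l * t ^ (1 / (n : ℝ)) := by positivity
  have hv0 : 4 * Real.exp 4 * l * t ^ (1 / (n : ℝ)) < v := by
    rw [hvE] at hcon
    exact (ENNReal.ofReal_lt_ofReal_iff_of_nonneg hB.le).1 hcon
  have hvpos := hB.trans hv0
  have hn0 : (n : ℝ) ≠ 0 := by positivity
  have htv : t * (4 * Real.exp 4 * l) ^ n ≤ v ^ n := by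
    have h1 : (4 * Real.exp 4 * l * t ^ (1 / (n : ℝ))) ^ n ≤ v ^ n := by gcongr
    rw [mul_pow, ← Real.rpow_natCast (t ^ (1 / (n : ℝ))), ← Real.rpow_mul ht.le,
      one_div_mul_cancel hn0, Real.rpow_one] at h1
    linarith
  -- Dividing by `n + 1` rather than `n` makes `n * h < v` strict, as the choice of nodes requires.
  set h : ℝ := v / (n + 1) with hh
  have hhpos : 0 < h := by positivity
  obtain ⟨x, hxE, hxs⟩ := exists_spaced_points (n := n) hEcl hEl hhpos (by
    rw [hvE, ENNReal.ofReal_lt_ofReal_iff hvpos, hh, mul_div_assoc', div_lt_iff₀ (by positivity)]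
    linarith)
  obtain ⟨P, hP, hP'⟩ := exists_interpolating_polynomial (g := G 0) (t := t) (l := l) hhpos hxs
    (fun i hi => (hxE i hi).1) (fun i hi => (hxE i hi).2)
  obtain ⟨y, hy0, hylt, hyz, hypos⟩ := exists_last_zeros n (l := l) (z := x)
    (H := fun j s => G j s - (Polynomial.derivative^[j] P).eval s)
    (fun j hj s hs => by
      rw [Function.iterate_succ_apply']
      exact (hG j (by omega) s hs).sub (Polynomial.hasDerivAt _ _))
    (fun i hi => by linarith [hxs i hi]) (fun i hi => (hxE i hi).1)
    (fun i hi => by simp [hP i hi])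
  have hyl : ∀ j ≤ n, y j ∈ Icc 0 l := by
    intro j hj
    refine ⟨(hxE 0 (by omega)).1.1.trans (hyz j hj).1, ?_⟩
    induction j with
    | zero => exact hy0 ▸ (hxE n le_rfl).1.2
    | succ j ih => exact (hylt j hj).le.trans (ih (by omega))
  have hM : ∀ j, 0 < ∏ i ∈ Finset.Icc 1 j, μ i := fun j =>
    Finset.prod_pos fun i hi => hμ i (Finset.mem_Icc.1 hi).1
  have hsmall : ∀ j ≤ n, |G j (y j)| ≤
      Real.exp (-((n + 1 : ℕ) : ℝ)) * (Real.exp j * ∏ i ∈ Finset.Icc 1 j, μ i) := by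
    intro j hj
    rw [sub_eq_zero.1 (hyz j hj).2]
    refine (hP' j hj _ (hyl j hj)).trans ?_
    -- Origin of the constant: one factor `2 ^ n` comes from interpolation and one from `n! ≤ 2 ^ n
    -- j! (n - j)!`, giving `4 ^ n`. The power of `e` must cover `e ^ (n + 1)` from `(n + 1) ^ n ≤
    -- n! e ^ (n + 1)` and the target `e ^ (-(n + 1))`; `e ^ (4 n)` does so because `n ≥ 1`.
    have h1 := factorial_le_prod_mul_pow hμ hmono hlow hj
    have h2 := factorial_le_two_pow_mul hj
    have h3 : ((n : ℝ) + 1) ^ n ≤ n.factorial * Real.exp (n + 1) := by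
      have := Real.pow_div_factorial_le_exp ((n : ℝ) + 1) (by positivity) n
      rw [div_le_iff₀ (by positivity)] at this
      linarith
    have h4 : (l ^ (n - j)) * l ^ j = l ^ n := by rw [← pow_add, Nat.sub_add_cancel hj]
    rw [div_le_iff₀ (by positivity), hh, div_pow, ← mul_div_assoc, ← mul_div_assoc,
      le_div_iff₀ (by positivity)]
    refine le_of_mul_le_mul_right ?_ (show 0 < 2 ^ n * Real.exp 4 ^ n * l ^ j by positivity)
    have h5 : Real.exp (n + 1) ≤ Real.exp (-((n + 1 : ℕ) : ℝ)) * Real.exp 4 ^ n := by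
      rw [← Real.exp_nat_mul, ← Real.exp_add]
      refine Real.exp_le_exp.2 ?_
      have : (1 : ℝ) ≤ n := by exact_mod_cast hn
      push_cast
      linarith
    have h6 : (n.factorial : ℝ) ≤ 2 ^ n * ((Real.exp j * (∏ i ∈ Finset.Icc 1 j, μ i) * l ^ j) *
        (n - j).factorial) := h2.trans (by gcongr)
    calc t * 2 ^ n * l ^ (n - j) * ((n : ℝ) + 1) ^ n * (2 ^ n * Real.exp 4 ^ n * l ^ j)
        = (t * (4 * Real.exp 4 * l) ^ n) * ((n : ℝ) + 1) ^ n := by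
          rw [mul_pow, mul_pow, ← h4, show (4 : ℝ) = 2 * 2 by norm_num, mul_pow 2 2]
          ring
      _ ≤ v ^ n * (n.factorial * Real.exp (n + 1)) := by gcongr
      _ ≤ v ^ n * ((2 ^ n * ((Real.exp j * (∏ i ∈ Finset.Icc 1 j, μ i) * l ^ j) *
            (n - j).factorial)) * (Real.exp (-((n + 1 : ℕ) : ℝ)) * Real.exp 4 ^ n)) := by
          exact mul_le_mul_of_nonneg_left (mul_le_mul h6 h5 (Real.exp_pos _).le
            ((Nat.cast_nonneg _).trans h6)) (by positivity)
      _ = _ := by ring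
  -- Dividing by `e ^ j μ 1 ⋯ μ j` turns the derivative bounds into `|W j| ≤ e ^ (-j)` and the rates
  -- into `e * μ j`.
  have hfin := chain_lt_one (W := fun j s => G j s / (Real.exp j * ∏ i ∈ Finset.Icc 1 j, μ i))
    (ν := fun j => Real.exp 1 * μ j) (p := n + 1) (l := l) (y := y)
    (fun j hj => mul_pos (Real.exp_pos 1) (hμ j hj))
    (fun i j hi hij => mul_le_mul_of_nonneg_left (hmono i j hi hij) (Real.exp_pos 1).le)
    (fun j hj s hs => by
      have h1 := (hG j hj s hs).div_const (Real.exp j * ∏ i ∈ Finset.Icc 1 j, μ i)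
      refine h1.congr_deriv ?_
      have := (hM j).ne'
      have := (hμ (j + 1) (by omega)).ne'
      rw [Finset.prod_Icc_succ_top (by omega), Nat.cast_succ, Real.exp_add]
      field_simp)
    (fun j hj s hs => by
      have := hM j
      rw [abs_div, abs_of_pos (by positivity : 0 < Real.exp j * ∏ i ∈ Finset.Icc 1 j, μ i),
        div_le_iff₀ (by positivity), ← mul_assoc, ← Real.exp_add, neg_add_cancel, Real.exp_zero,
        one_mul]
      exact hb j hj s hs)
    (by omega) (hyl 0 (by omega)).2 (fun j hj => (hylt j (by omega)).le)
    ((hxE 0 (by omega)).1.1.trans_lt (hypos hn))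
    (fun j hj => by
      have := hM j
      rw [abs_div, abs_of_pos (by positivity : 0 < Real.exp j * ∏ i ∈ Finset.Icc 1 j, μ i),
        div_le_iff₀ (by positivity)]
      exact hsmall j (by omega))
    (by
      simp only [one_div, mul_inv] at hup ⊢
      rw [← Finset.mul_sum, ← div_eq_inv_mul, le_div_iff₀ (Real.exp_pos 1)]
      linarith)
  simp [hone] at hfin

/-- One-dimensional Remez inequality for a chain that attains its supremum at an endpoint. -/
theorem volume_sublevel_segment_le {G : ℕ → ℝ → ℝ} {μ : ℕ → ℝ} {n : ℕ} {l t M : ℝ}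
    (hμ : ∀ j, 1 ≤ j → 0 < μ j) (hmono : ∀ i j, 1 ≤ i → i ≤ j → μ i ≤ μ j) (hl : 0 < l)
    (hn : 1 ≤ n) (ht : 0 < t) (hM : 0 < M)
    (hG : ∀ j < 2 * n, ∀ s ∈ Icc 0 l, HasDerivAt (G j) (G (j + 1) s) s)
    (hb : ∀ j ≤ 2 * n, ∀ s ∈ Icc 0 l, |G j s| ≤ M * ∏ i ∈ Finset.Icc 1 j, μ i)
    (hone : |G 0 l| = M)
    (hup : Real.exp 1 * l ≤ ∑ j ∈ Finset.Icc 1 (n + 1), 1 / μ j) :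
    volume {s | s ∈ Icc 0 l ∧ |G 0 s| ≤ t} ≤
      ENNReal.ofReal (4 * Real.exp 4 * l * (t / M) ^ (1 / (2 * (n : ℝ)))) := by
  have hn' : (1 : ℝ) ≤ n := by exact_mod_cast hn
  have hexp : 1 ≤ Real.exp 4 := Real.one_le_exp (by norm_num)
  have htriv : l ≤ 4 * Real.exp 4 * l * (t / M) ^ (1 / (2 * (n : ℝ))) →
      volume {s | s ∈ Icc 0 l ∧ |G 0 s| ≤ t} ≤
        ENNReal.ofReal (4 * Real.exp 4 * l * (t / M) ^ (1 / (2 * (n : ℝ)))) := by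
    intro h
    refine (measure_mono (fun s hs => hs.1 : _ ⊆ Icc 0 l)).trans ?_
    rw [Real.volume_Icc, sub_zero]
    exact ENNReal.ofReal_le_ofReal h
  have hτ : 0 < t / M := by positivity
  rcases le_or_gt 1 (t / M) with h1 | h1
  · apply htriv
    have := Real.one_le_rpow h1 (show 0 ≤ 1 / (2 * (n : ℝ)) by positivity)
    nlinarith [mul_le_mul hexp this (by norm_num) (by positivity)]
  -- The least such `p = q + 1` makes `e * l` lie between two consecutive partial sums, so that the
  -- chain estimate applies with `q ≤ n` in place of `n`.
  have hex : ∃ p, Real.exp 1 * l ≤ ∑ j ∈ Finset.Icc 1 p, 1 / μ j := ⟨_, hup⟩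
  classical
  obtain ⟨p, hp, hpmin⟩ : ∃ p, (Real.exp 1 * l ≤ ∑ j ∈ Finset.Icc 1 p, 1 / μ j) ∧
      ∀ q < p, ¬ Real.exp 1 * l ≤ ∑ j ∈ Finset.Icc 1 q, 1 / μ j :=
    ⟨Nat.find hex, Nat.find_spec hex, fun q hq => Nat.find_min hex hq⟩
  have hpn : p ≤ n + 1 := not_lt.1 fun h => hpmin _ h hup
  have hp0 : p ≠ 0 := by
    rintro rfl
    have : 0 < Real.exp 1 * l := by positivity
    simp at hp
    linarith
  obtain ⟨q, rfl⟩ := Nat.exists_eq_succ_of_ne_zero hp0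
  rcases Nat.eq_zero_or_pos q with rfl | hq
  -- Here `e * l * μ 1 ≤ 1`: by the mean value inequality `G 0` varies by at most `M / e < M / 2`,
  -- so the sublevel set is empty when `t < M / 2`.
  · rcases le_or_gt (1 / 2) (t / M) with h2 | h2
    · apply htriv
      have h3 : t / M ≤ (t / M) ^ (1 / (2 * (n : ℝ))) := by
        conv_lhs => rw [← Real.rpow_one (t / M)]
        refine Real.rpow_le_rpow_of_exponent_ge hτ h1.le ?_
        rw [div_le_one (by positivity)]
        linarith
      nlinarith [mul_le_mul hexp (h2.trans h3) (by norm_num) (by positivity)]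
    · have hempty : {s | s ∈ Icc 0 l ∧ |G 0 s| ≤ t} = ∅ := by
        rw [eq_empty_iff_forall_notMem]
        rintro s ⟨hs, hst⟩
        have hlip := (convex_Icc 0 l).norm_image_sub_le_of_norm_hasDerivWithin_le
          (fun x hx => (hG 0 (by omega) x hx).hasDerivWithinAt)
          (fun x hx => by simpa using hb 1 (by omega) x hx) hs (right_mem_Icc.2 hl.le)
        have h4 : Real.exp 1 * l ≤ 1 / μ 1 := by simpa using hp
        rw [le_div_iff₀ (hμ 1 le_rfl)] at h4
        have h5 : |l - s| ≤ l := by rw [abs_le]; constructor <;> linarith [hs.1, hs.2]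
        have h6 : |G 0 l| - |G 0 s| ≤ |G 0 l - G 0 s| := abs_sub_abs_le_abs_sub _ _
        rw [Real.norm_eq_abs, Real.norm_eq_abs] at hlip
        rw [hone] at h6
        have h7 : M * μ 1 * |l - s| ≤ M * μ 1 * l :=
          mul_le_mul_of_nonneg_left h5 (mul_pos hM (hμ 1 le_rfl)).le
        have h8 : 2 < Real.exp 1 := lt_trans (by norm_num) Real.exp_one_gt_d9
        have h9 : 2 * (l * μ 1) ≤ 1 := by
          have := mul_pos hl (hμ 1 le_rfl)
          nlinarith
        rw [div_lt_iff₀ hM] at h2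
        nlinarith
      rw [hempty]
      simp
  · have hMi : ∀ x : ℝ, |x / M| = |x| / M := fun x => by rw [abs_div, abs_of_pos hM]
    have hmain := volume_sublevel_chain_le (G := fun j s => G j s / M) (t := t / M) hμ hmono hl hq
      hτ (fun j hj s hs => (hG j (by omega) s hs).div_const M)
      (fun j hj s hs => by
        rw [hMi, div_le_iff₀ hM, mul_comm]
        exact hb j (by omega) s hs)
      (by rw [hMi, hone, div_self hM.ne']) (not_le.1 (hpmin q (by omega))).le hp
    have hset : {s | s ∈ Icc 0 l ∧ |G 0 s / M| ≤ t / M} = {s | s ∈ Icc 0 l ∧ |G 0 s| ≤ t} := by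
      ext s
      simp only [mem_ofPred_eq, hMi, div_le_div_iff_of_pos_right hM]
    rw [hset] at hmain
    refine hmain.trans (ENNReal.ofReal_le_ofReal ?_)
    refine mul_le_mul_of_nonneg_left ?_ (by positivity)
    refine Real.rpow_le_rpow_of_exponent_ge hτ h1.le ?_
    have hq' : (1 : ℝ) ≤ q := by exact_mod_cast hq
    have hqn : (q : ℝ) ≤ n := by exact_mod_cast (show q ≤ n by omega)
    exact one_div_le_one_div_of_le (by positivity) (by linarith)


/-! ### Directional derivatives in terms of multi-indices. -/

section DirectionalDerivatives

variable {d : ℕ} {U : Set (EuclideanSpace ℝ (Fin d))} {f g h : EuclideanSpace ℝ (Fin d) → ℝ}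

theorem partialDeriv_eq_fderiv {x : EuclideanSpace ℝ (Fin d)} (hg : DifferentiableAt ℝ g x)
    (i : Fin d) : partialDeriv i g x = fderiv ℝ g x (EuclideanSpace.single i 1) :=
  hg.lineDeriv_eq_fderiv

theorem partialDeriv_eqOn (hU : IsOpen U) (hgh : EqOn g h U) (i : Fin d) :
    EqOn (partialDeriv i g) (partialDeriv i h) U := fun _ hx =>
  Filter.EventuallyEq.lineDeriv_eq (Filter.eventuallyEq_of_mem (hU.mem_nhds hx) hgh)

theorem eqOn_partialDeriv_fderiv (hU : IsOpen U) {k : ℕ} (hg : ContDiffOn ℝ ((k + 1 : ℕ) : ℕ∞) g U)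
    (i : Fin d) :
    EqOn (partialDeriv i g) (fun x => fderiv ℝ g x (EuclideanSpace.single i 1)) U := fun _ hx =>
  partialDeriv_eq_fderiv ((hg.differentiableOn (by simp)).differentiableAt (hU.mem_nhds hx)) i

theorem contDiffOn_partialDeriv (hU : IsOpen U) {k : ℕ}
    (hg : ContDiffOn ℝ ((k + 1 : ℕ) : ℕ∞) g U) (i : Fin d) :
    ContDiffOn ℝ (k : ℕ∞) (partialDeriv i g) U := by
  refine ContDiffOn.congr ?_ (eqOn_partialDeriv_fderiv hU hg i)
  exact (hg.fderiv_of_isOpen hU (by simp)).clm_apply contDiffOn_const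

theorem partialDeriv_comm (hU : IsOpen U) (hg : ContDiffOn ℝ ((2 : ℕ) : ℕ∞) g U) (i j : Fin d) :
    EqOn (partialDeriv i (partialDeriv j g)) (partialDeriv j (partialDeriv i g)) U := by
  have key : ∀ a b : Fin d, ∀ x ∈ U, partialDeriv a (partialDeriv b g) x =
      fderiv ℝ (fderiv ℝ g) x (EuclideanSpace.single a 1) (EuclideanSpace.single b 1) := by
    intro a b x hx
    have hd : DifferentiableAt ℝ (fderiv ℝ g) x :=
      ((hg.fderiv_of_isOpen (m := 1) hU (by norm_num)).differentiableOn
        (by simp)).differentiableAt (hU.mem_nhds hx)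
    rw [partialDeriv_eqOn hU (eqOn_partialDeriv_fderiv (k := 1) hU hg b) a hx,
      partialDeriv_eq_fderiv (hd.clm_apply (differentiableAt_const _)), fderiv_clm_apply hd
      (differentiableAt_const _)]
    simp
  intro x hx
  rw [key i j x hx, key j i x hx]
  exact (hg.contDiffAt (hU.mem_nhds hx)).isSymmSndFDerivAt (by simp) _ _

theorem contDiffOn_foldr_partialDeriv (hU : IsOpen U) {n : ℕ} (hf : ContDiffOn ℝ (n : ℕ∞) f U)
    (L : List (Fin d)) {k : ℕ} (hk : L.length + k = n) :
    ContDiffOn ℝ (k : ℕ∞) (L.foldr partialDeriv f) U := by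
  induction L generalizing k with
  | nil =>
    obtain rfl : k = n := by simpa using hk
    exact hf
  | cons i L ih =>
    refine contDiffOn_partialDeriv hU (ih ?_) i
    rw [List.length_cons] at hk
    omega

/-- Permutations are generated by adjacent swaps. A swap is Schwarz's theorem for the inner
derivative, which is still `C²` because the list has length at most `n`. -/
theorem foldr_partialDeriv_perm (hU : IsOpen U) {n : ℕ} (hf : ContDiffOn ℝ (n : ℕ∞) f U)
    {L L' : List (Fin d)} (hp : L.Perm L') (hL : L.length ≤ n) :
    EqOn (L.foldr partialDeriv f) (L'.foldr partialDeriv f) U := by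
  induction hp with
  | nil => exact fun x _ => rfl
  | cons i _ ih =>
    rw [List.length_cons] at hL
    exact partialDeriv_eqOn hU (ih (by omega)) i
  | swap i j L =>
    simp only [List.length_cons] at hL
    refine partialDeriv_comm hU ?_ j i
    refine (contDiffOn_foldr_partialDeriv hU hf L (k := n - L.length) (by omega)).of_le ?_
    exact WithTop.coe_le_coe.2 (Nat.cast_le.2 (show 2 ≤ n - L.length by omega))
  | trans h1 _ ih1 ih2 =>
    exact (ih1 hL).trans (ih2 (h1.length_eq ▸ hL))

/-- The list of indices in which `multiDeriv α` differentiates. -/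
def multiIndexList (α : Fin d → ℕ) : List (Fin d) :=
  (List.finRange d).flatMap fun i => List.replicate (α i) i

theorem multiDeriv_eq_foldr (α : Fin d → ℕ) (f : EuclideanSpace ℝ (Fin d) → ℝ) :
    multiDeriv α f = (multiIndexList α).foldr partialDeriv f := by
  have hrep : ∀ (i : Fin d) (n : ℕ) (g : EuclideanSpace ℝ (Fin d) → ℝ),
      (List.replicate n i).foldr partialDeriv g = (partialDeriv i)^[n] g := by
    intro i n g
    induction n with
    | zero => rfl
    | succ n ih => rw [List.replicate_succ, List.foldr_cons, ih, Function.iterate_succ_apply']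
  unfold multiDeriv multiIndexList
  induction List.finRange d with
  | nil => rfl
  | cons i L ih => rw [List.foldr_cons, List.flatMap_cons, List.foldr_append, ih, hrep]

theorem length_multiIndexList (α : Fin d → ℕ) : (multiIndexList α).length = ∑ i, α i := by
  simp [multiIndexList, List.length_flatMap, Fin.sum_univ_def]

theorem count_multiIndexList (α : Fin d → ℕ) (a : Fin d) :
    (multiIndexList α).count a = α a := by
  rw [multiIndexList, List.count_flatMap, ← Fin.sum_univ_def]
  simp [List.count_replicate]

theorem contDiffOn_multiDeriv (hU : IsOpen U) {n : ℕ} (hf : ContDiffOn ℝ (n : ℕ∞) f U)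
    {α : Fin d → ℕ} {k : ℕ} (hk : ∑ i, α i + k = n) :
    ContDiffOn ℝ (k : ℕ∞) (multiDeriv α f) U := by
  rw [multiDeriv_eq_foldr]
  exact contDiffOn_foldr_partialDeriv hU hf _ (by rw [length_multiIndexList, hk])

theorem partialDeriv_multiDeriv (hU : IsOpen U) {n : ℕ} (hf : ContDiffOn ℝ (n : ℕ∞) f U)
    {α : Fin d → ℕ} (hα : ∑ i, α i < n) (i : Fin d) :
    EqOn (partialDeriv i (multiDeriv α f)) (multiDeriv (α + Pi.single i 1) f) U := by
  rw [multiDeriv_eq_foldr, multiDeriv_eq_foldr]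
  refine foldr_partialDeriv_perm (L := i :: multiIndexList α) hU hf ?_ ?_
  · rw [List.perm_iff_count]
    intro a
    rw [List.count_cons, count_multiIndexList, count_multiIndexList, Pi.add_apply]
    congr 1
    by_cases h : i = a
    · subst h; simp
    · simp [h, Ne.symm h]
  · rw [List.length_cons, length_multiIndexList]
    omega

/-- The `j`-th directional derivative of `f` in direction `θ`, in multinomial form. -/
noncomputable def dirDeriv (f : EuclideanSpace ℝ (Fin d) → ℝ) (θ : EuclideanSpace ℝ (Fin d))
    (j : ℕ) (x : EuclideanSpace ℝ (Fin d)) : ℝ :=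
  ∑ α ∈ Finset.piAntidiag (Finset.univ : Finset (Fin d)) j,
    ((j.factorial : ℝ) / ∏ i, ((α i).factorial : ℝ)) * (∏ i, θ i ^ α i) * multiDeriv α f x

/-- Pascal's rule for multinomial coefficients: write `(j + 1)! / β!` as `∑ i, β i * j! / β!` and
substitute `β = α + e_i`. Indices with `β i = 0` are not of this form, but their terms vanish. -/
theorem sum_piAntidiag_succ (θ : Fin d → ℝ) (F : (Fin d → ℕ) → ℝ) (j : ℕ) :
    ∑ α ∈ Finset.piAntidiag (Finset.univ : Finset (Fin d)) j,
      ((j.factorial : ℝ) / ∏ i, ((α i).factorial : ℝ)) * (∏ i, θ i ^ α i) *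
        ∑ i, θ i * F (α + Pi.single i 1) =
    ∑ β ∈ Finset.piAntidiag (Finset.univ : Finset (Fin d)) (j + 1),
      (((j + 1).factorial : ℝ) / ∏ i, ((β i).factorial : ℝ)) * (∏ i, θ i ^ β i) * F β := by
  have hR : ∀ β ∈ Finset.piAntidiag (Finset.univ : Finset (Fin d)) (j + 1),
      (((j + 1).factorial : ℝ) / ∏ i, ((β i).factorial : ℝ)) * (∏ i, θ i ^ β i) * F β =
      ∑ i, (β i : ℝ) * ((j.factorial : ℝ) / ∏ i, ((β i).factorial : ℝ)) *
        (∏ i, θ i ^ β i) * F β := by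
    intro β hβ
    rw [Finset.mem_piAntidiag] at hβ
    rw [← Finset.sum_mul, ← Finset.sum_mul, ← Finset.sum_mul, ← Nat.cast_sum, hβ.1,
      Nat.factorial_succ]
    push_cast
    ring
  rw [Finset.sum_congr rfl hR, Finset.sum_comm]
  simp_rw [Finset.mul_sum]
  rw [Finset.sum_comm]
  refine Finset.sum_congr rfl fun i _ => ?_
  refine Finset.sum_of_injOn (fun α => α + Pi.single i 1) (fun a _ b _ hab => add_right_cancel hab)
    ?_ ?_ ?_
  · intro α hα
    simp only [Finset.mem_coe, Finset.mem_piAntidiag, Finset.mem_univ, implies_true, and_true]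
      at hα ⊢
    simp [Finset.sum_add_distrib, hα]
  · intro β hβ hβ'
    have h0 : β i = 0 := by
      by_contra h0
      have hγ : (β - Pi.single i 1 : Fin d → ℕ) + Pi.single i 1 = β := by
        funext k
        by_cases hk : k = i
        · subst hk; simp; omega
        · simp [hk]
      refine hβ' ⟨β - Pi.single i 1, ?_, hγ⟩
      have hsum : ∑ k, ((β - Pi.single i 1 : Fin d → ℕ) + Pi.single i 1 : Fin d → ℕ) k = j + 1 := by
        rw [hγ]
        exact (Finset.mem_piAntidiag.1 hβ).1
      simp only [Pi.add_apply, Finset.sum_add_distrib, Finset.sum_pi_single', Finset.mem_univ,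
        if_true, add_left_inj] at hsum
      exact Finset.mem_coe.2 (Finset.mem_piAntidiag.2 ⟨hsum, fun k _ => Finset.mem_univ k⟩)
    simp [h0]
  · intro α _
    have h1 : ∏ k, ((((α + Pi.single i 1 : Fin d → ℕ)) k).factorial : ℝ) =
        (α i + 1) * ∏ k, ((α k).factorial : ℝ) := by
      rw [← Finset.mul_prod_erase _ _ (Finset.mem_univ i),
        ← Finset.mul_prod_erase _ (fun k => ((α k).factorial : ℝ)) (Finset.mem_univ i),
        Finset.prod_congr rfl (g := fun k => ((α k).factorial : ℝ)) fun k hk => by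
          simp [Finset.ne_of_mem_erase hk]]
      simp [Nat.factorial_succ]
      ring
    have h2 : ∏ k, θ k ^ ((α + Pi.single i 1 : Fin d → ℕ) k) = θ i * ∏ k, θ k ^ α k := by
      rw [← Finset.mul_prod_erase _ _ (Finset.mem_univ i),
        ← Finset.mul_prod_erase _ (fun k => θ k ^ α k) (Finset.mem_univ i),
        Finset.prod_congr rfl (g := fun k => θ k ^ α k) fun k hk => by
          simp [Finset.ne_of_mem_erase hk]]
      simp [pow_succ]
      ring
    have h3 : (∏ k, ((α k).factorial : ℝ)) ≠ 0 :=
      Finset.prod_ne_zero_iff.2 fun k _ => by positivity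
    have h4 : (α i : ℝ) + 1 ≠ 0 := by positivity
    rw [h1, h2]
    simp
    field_simp

theorem hasDerivAt_dirDeriv (hU : IsOpen U) {n : ℕ} (hf : ContDiffOn ℝ (n : ℕ∞) f U)
    (θ p : EuclideanSpace ℝ (Fin d)) {j : ℕ} (hj : j < n) {s : ℝ} (hs : p + s • θ ∈ U) :
    HasDerivAt (fun s : ℝ => dirDeriv f θ j (p + s • θ)) (dirDeriv f θ (j + 1) (p + s • θ)) s := by
  unfold dirDeriv
  rw [← sum_piAntidiag_succ θ (fun β => multiDeriv β f (p + s • θ))]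
  refine HasDerivAt.fun_sum fun α hα => HasDerivAt.const_mul _ ?_
  have hα : ∑ i, α i = j := (Finset.mem_piAntidiag.1 hα).1
  have hd : DifferentiableAt ℝ (multiDeriv α f) (p + s • θ) :=
    ((contDiffOn_multiDeriv hU hf (α := α) (k := n - j) (by omega)).differentiableOn
      (by
        have : n - j ≠ 0 := by omega
        exact_mod_cast this)).differentiableAt (hU.mem_nhds hs)
  have hline : HasDerivAt (fun s : ℝ => p + s • θ) θ s := by
    simpa using ((hasDerivAt_id s).smul_const θ).const_add p
  have hcomp := hd.hasFDerivAt.comp_hasDerivAt s hline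
  refine hcomp.congr_deriv ?_
  have hθ : θ = ∑ i, θ i • EuclideanSpace.single i (1 : ℝ) := by
    ext k
    simp [Finset.sum_apply, Pi.single_apply]
  rw [congrArg (fderiv ℝ (multiDeriv α f) (p + s • θ)) hθ, map_sum]
  refine Finset.sum_congr rfl fun i _ => ?_
  rw [map_smul, smul_eq_mul, ← partialDeriv_eq_fderiv hd,
    partialDeriv_multiDeriv hU hf (by omega) i hs]

theorem abs_le_supNorm {K : Set (EuclideanSpace ℝ (Fin d))} (hK : IsCompact K)
    (hg : ContinuousOn g K) {x : EuclideanSpace ℝ (Fin d)} (hx : x ∈ K) : |g x| ≤ supNorm K g :=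
  le_csSup (hK.bddAbove_image hg.abs) (mem_image_of_mem _ hx)

theorem abs_dirDeriv_le_derivNorm (hU : IsOpen U) {n : ℕ} (hf : ContDiffOn ℝ (n : ℕ∞) f U)
    {K : Set (EuclideanSpace ℝ (Fin d))} (hK : IsCompact K) (hKU : K ⊆ U)
    {θ : EuclideanSpace ℝ (Fin d)} (hθ : ‖θ‖ ≤ 1) {j : ℕ} (hj : j ≤ n)
    {x : EuclideanSpace ℝ (Fin d)} (hx : x ∈ K) : |dirDeriv f θ j x| ≤ derivNorm j K f := by
  unfold dirDeriv derivNorm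
  refine (Finset.abs_sum_le_sum_abs _ _).trans (Finset.sum_le_sum fun α hα => ?_)
  have hα : ∑ i, α i = j := (Finset.mem_piAntidiag.1 hα).1
  have h0 : 0 ≤ (j.factorial : ℝ) / ∏ i, ((α i).factorial : ℝ) := by positivity
  rw [abs_mul, abs_mul, abs_of_nonneg h0, mul_assoc]
  refine mul_le_mul_of_nonneg_left ?_ h0
  have h1 : |∏ i, θ i ^ α i| ≤ 1 := by
    rw [Finset.abs_prod]
    refine Finset.prod_le_one (fun _ _ => abs_nonneg _) fun i _ => ?_
    rw [abs_pow]
    exact pow_le_one₀ (abs_nonneg _) ((PiLp.norm_apply_le θ i).trans hθ)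
  have h2 := abs_le_supNorm hK
    ((contDiffOn_multiDeriv hU hf (α := α) (k := n - j) (by omega)).continuousOn.mono hKU) hx
  exact (mul_le_of_le_one_left (abs_nonneg _) h1).trans h2

theorem dirDeriv_zero (f : EuclideanSpace ℝ (Fin d) → ℝ) (θ x : EuclideanSpace ℝ (Fin d)) :
    dirDeriv f θ 0 x = f x := by
  have : multiDeriv (0 : Fin d → ℕ) f = f := by
    rw [multiDeriv_eq_foldr]
    have : multiIndexList (0 : Fin d → ℕ) = [] :=
      List.length_eq_zero_iff.1 (by simp [length_multiIndexList])
    rw [this]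
    rfl
  simp [dirDeriv, this]


end DirectionalDerivatives

/-! ### Polar coordinates and comparison along rays. -/

theorem volume_eq_lintegral_polar {E : Type*} [NormedAddCommGroup E] [NormedSpace ℝ E]
    [MeasurableSpace E] [BorelSpace E] [FiniteDimensional ℝ E] [Nontrivial E] (ν : Measure E)
    [ν.IsAddHaarMeasure] {A : Set E} (hA : MeasurableSet A) :
    ν A = ∫⁻ θ : Metric.sphere (0 : E) 1,
      Measure.volumeIoiPow (Module.finrank ℝ E - 1) {r | r.1 • θ.1 ∈ A} ∂ν.toSphere := by
  set S : Set (Metric.sphere (0 : E) 1 × Ioi (0 : ℝ)) := {q | q.2.1 • q.1.1 ∈ A} with hS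
  have hSm : MeasurableSet S := by
    have hm : Measurable fun q : Metric.sphere (0 : E) 1 × Ioi (0 : ℝ) => q.2.1 • q.1.1 := by
      fun_prop
    exact hm hA
  have h1 := (ν.measurePreserving_homeomorphUnitSphereProd).measure_preimage hSm.nullMeasurableSet
  have h2 : homeomorphUnitSphereProd E ⁻¹' S = Subtype.val ⁻¹' A := by
    ext x
    have hx : ‖(x : E)‖ ≠ 0 := norm_ne_zero_iff.2 x.2
    simp only [hS, mem_preimage, mem_ofPred_eq, homeomorphUnitSphereProd_apply_fst_coe,
      homeomorphUnitSphereProd_apply_snd_coe, smul_smul, mul_inv_cancel₀ hx, one_smul]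
  rw [h2, comap_subtype_coe_apply (measurableSet_singleton _).compl, Subtype.image_preimage_coe,
    Measure.prod_apply hSm] at h1
  have h3 : ν ({0}ᶜ ∩ A) = ν A := by
    rw [inter_comm, ← sdiff_eq, measure_sdiff_null (measure_singleton _)]
  rw [← h3, h1]
  rfl

theorem measure_le_mul_of_polar {E : Type*} [NormedAddCommGroup E] [NormedSpace ℝ E]
    [MeasurableSpace E] [BorelSpace E] [FiniteDimensional ℝ E] [Nontrivial E] (ν : Measure E)
    [ν.IsAddHaarMeasure] {A B : Set E} (hA : MeasurableSet A) (hB : MeasurableSet B)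
    {c : ENNReal} (hc : c ≠ ⊤)
    (h : ∀ θ : Metric.sphere (0 : E) 1,
      Measure.volumeIoiPow (Module.finrank ℝ E - 1) {r | r.1 • θ.1 ∈ A} ≤
        c * Measure.volumeIoiPow (Module.finrank ℝ E - 1) {r | r.1 • θ.1 ∈ B}) :
    ν A ≤ c * ν B := by
  rw [volume_eq_lintegral_polar ν hA, volume_eq_lintegral_polar ν hB,
    ← lintegral_const_mul' _ _ hc]
  exact lintegral_mono h

theorem volumeIoiPow_le (n : ℕ) {S : Set (Ioi (0 : ℝ))} (hS : MeasurableSet S) {l : ℝ}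
    (hl : ∀ r ∈ S, r.1 ≤ l) :
    Measure.volumeIoiPow n S ≤ ENNReal.ofReal (l ^ n) * volume (Subtype.val '' S) := by
  rw [Measure.volumeIoiPow, withDensity_apply _ hS]
  calc ∫⁻ r in S, ENNReal.ofReal (r.1 ^ n) ∂(Measure.comap Subtype.val volume)
      ≤ ∫⁻ _ in S, ENNReal.ofReal (l ^ n) ∂(Measure.comap Subtype.val volume) := by
        refine setLIntegral_mono' hS fun r hr => ENNReal.ofReal_le_ofReal ?_
        exact pow_le_pow_left₀ r.2.le (hl r hr) n
    _ = _ := by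
        rw [setLIntegral_const, comap_subtype_coe_apply measurableSet_Ioi]

/-- If the sublevel set occupies at most a proportion `c` of every segment of `K` that starts at
`x₀`, then it occupies at most a proportion `d * c` of `K`. -/
theorem volume_le_of_rays {d : ℕ} (hd : 1 ≤ d) {K S : Set (EuclideanSpace ℝ (Fin d))}
    (hK : IsCompact K) (hKc : Convex ℝ K) (hS : IsClosed S) (hSK : S ⊆ K)
    {x₀ : EuclideanSpace ℝ (Fin d)} (hx₀ : x₀ ∈ K) {c : ℝ} (hc : 0 ≤ c)
    (h : ∀ θ : EuclideanSpace ℝ (Fin d), ‖θ‖ = 1 → ∀ l : ℝ, 0 < l → x₀ + l • θ ∈ K →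
      volume {r : ℝ | r ∈ Icc 0 l ∧ x₀ + r • θ ∈ S} ≤ ENNReal.ofReal (c * l)) :
    volume S ≤ ENNReal.ofReal (c * d) * volume K := by
  have : Nonempty (Fin d) := ⟨⟨0, hd⟩⟩
  have htrans : ∀ F : Set (EuclideanSpace ℝ (Fin d)), volume ((fun x => x₀ + x) ⁻¹' F) = volume F :=
    fun F => measure_preimage_add _ _ _
  have hcont : Continuous fun x : EuclideanSpace ℝ (Fin d) => x₀ + x := by fun_prop
  rw [← htrans S, ← htrans K]
  refine measure_le_mul_of_polar volume (hS.preimage hcont).measurableSet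
    (hK.isClosed.preimage hcont).measurableSet ENNReal.ofReal_ne_top ?_
  rintro ⟨θ, hθ⟩
  rw [mem_sphere_zero_iff_norm] at hθ
  rw [finrank_euclideanSpace_fin]
  obtain ⟨n, rfl⟩ : ∃ n, d = n + 1 := ⟨d - 1, by omega⟩
  rw [Nat.add_sub_cancel]
  set R : Set ℝ := {r | 0 < r ∧ x₀ + r • θ ∈ K} with hR
  -- In directions that leave `K` at once there is nothing to compare. Otherwise the ray meets `K`
  -- up to the maximal length `l`, attained by compactness.
  rcases R.eq_empty_or_nonempty with hRe | ⟨r₀, hr₀⟩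
  · have : {r : Ioi (0 : ℝ) | r.1 • θ ∈ (fun x => x₀ + x) ⁻¹' S} = ∅ := by
      rw [eq_empty_iff_forall_notMem]
      intro r hr
      have : r.1 ∈ R := ⟨r.2, hSK hr⟩
      simp [hRe] at this
    rw [this]
    simp
  have hray : Continuous fun r : ℝ => x₀ + r • θ := by fun_prop
  have hRbdd : BddAbove R := by
    refine ⟨Metric.diam K, fun r hr => ?_⟩
    have h1 := Metric.dist_le_diam_of_mem hK.isBounded hr.2 hx₀
    rw [dist_eq_norm, add_sub_cancel_left, norm_smul, hθ, mul_one] at h1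
    exact (le_abs_self r).trans h1
  set l := sSup R with hl
  have hl0 : 0 < l := hr₀.1.trans_le (le_csSup hRbdd hr₀)
  have hlK : x₀ + l • θ ∈ K := by
    have h1 : l ∈ closure R := csSup_mem_closure ⟨r₀, hr₀⟩ hRbdd
    have h2 : closure R ⊆ (fun r : ℝ => x₀ + r • θ) ⁻¹' K :=
      closure_minimal (fun r hr => hr.2) (hK.isClosed.preimage hray)
    exact h2 h1
  have hlow : ENNReal.ofReal (l ^ (n + 1) / (n + 1)) ≤
      Measure.volumeIoiPow n {r : Ioi (0 : ℝ) | r.1 • θ ∈ (fun x => x₀ + x) ⁻¹' K} := by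
    rw [← Measure.volumeIoiPow_apply_Iio n ⟨l, hl0⟩]
    refine measure_mono fun r hr => ?_
    have hrl : r.1 < l := hr
    have hr0 : 0 < r.1 := r.2
    have h1 := hKc.add_smul_sub_mem hx₀ hlK (t := r.1 / l)
      ⟨by positivity, (div_le_one hl0).2 hrl.le⟩
    rwa [add_sub_cancel_left, smul_smul, div_mul_cancel₀ _ hl0.ne'] at h1
  have hup : Measure.volumeIoiPow n {r : Ioi (0 : ℝ) | r.1 • θ ∈ (fun x => x₀ + x) ⁻¹' S} ≤
      ENNReal.ofReal (l ^ n) * ENNReal.ofReal (c * l) := by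
    refine (volumeIoiPow_le n (l := l) ?_ ?_).trans (mul_le_mul_right ?_ _)
    · exact ((hS.preimage (hray.comp continuous_subtype_val))).measurableSet
    · exact fun r hr => le_csSup hRbdd ⟨r.2, hSK hr⟩
    · refine (measure_mono ?_).trans (h θ hθ l hl0 hlK)
      rintro _ ⟨r, hr, rfl⟩
      exact ⟨⟨r.2.le, le_csSup hRbdd ⟨r.2, hSK hr⟩⟩, hr⟩
  -- The factor `d = n + 1` is the ratio of `l ^ n * l` to the weighted length `l ^ (n + 1) / (n +
  -- 1)`.
  refine hup.trans ((le_of_eq ?_).trans (mul_le_mul_right hlow _))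
  rw [← ENNReal.ofReal_mul (by positivity), ← ENNReal.ofReal_mul (by positivity)]
  congr 1
  push_cast
  field_simp
  ring

/-! ### The constants of the statement and the conclusion. -/

/-- One-sided derivatives of an increasing function are nonnegative. The bound also holds if the set
is unbounded, where the real `sSup` is `0` by convention. -/
theorem gam_nonneg {m : ℝ → ℝ} {μ : ℕ → ℝ} (hm : IsInterpolant m μ) (n : ℕ) : 0 ≤ gam m n := by
  refine Real.sSup_nonneg ?_
  rintro _ ⟨s, hs, rfl⟩
  have hs0 : 0 ≤ s := zero_le_one.trans hs.1
  refine div_nonneg (mul_nonneg hs0 ?_) (hm.pos s hs.1).le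
  unfold oneSidedDeriv
  split_ifs with h1
  · exact hm.mono.derivWithin_nonneg
  · have h2 : 1 < s := lt_of_le_of_ne hs.1 (Ne.symm h1)
    rw [← derivWithin_inter (Ici_mem_nhds h2)]
    exact (hm.mono.mono inter_subset_right).derivWithin_nonneg

theorem le_sum_of_associatedInteger {d N : ℕ} {μ : ℕ → ℝ} {K : Set (EuclideanSpace ℝ (Fin d))}
    (hN : (N : ℕ∞) = associatedInteger μ K) :
    1 ≤ N ∧ 0 < Metric.diam K ∧
      Real.exp 1 * Metric.diam K ≤ ∑ j ∈ Finset.Icc 1 N, 1 / μ j := by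
  unfold associatedInteger degree at hN
  have hj : jZero 1 = 0 := by simp [jZero]
  rw [hj, zero_add] at hN
  have hN1 : 1 ≤ N := by
    have : (1 : ℕ∞) ≤ N := by rw [hN]; exact le_add_self
    exact_mod_cast this
  have hnot : ¬ sigma (fun j => Metric.diam K * μ j) 1 N < Real.exp 1 := by
    intro h
    have h1 : (N : ℕ∞) ≤ sSup ((fun n : ℕ => (n : ℕ∞)) ''
        {n : ℕ | sigma (fun j => Metric.diam K * μ j) 1 n < Real.exp 1}) :=
      le_sSup ⟨N, h, rfl⟩
    have h2 := add_le_add_left h1 1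
    rw [← hN] at h2
    have h3 : N + 1 ≤ N := by exact_mod_cast h2
    omega
  rw [not_lt] at hnot
  unfold sigma at hnot
  -- For diameter zero every term `1 / (0 * μ j)` would be `0` by convention, and the sum could not
  -- reach `e`.
  have hdiam : 0 < Metric.diam K := by
    refine lt_of_le_of_ne Metric.diam_nonneg fun h0 => ?_
    rw [← h0] at hnot
    simp at hnot
    exact absurd hnot (not_le.2 (Real.exp_pos 1))
  refine ⟨hN1, hdiam, ?_⟩
  simp only [one_div, mul_inv] at hnot ⊢
  rwa [← Finset.mul_sum, ← div_eq_inv_mul, le_div_iff₀ hdiam] at hnot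

end Remez

theorem mainTheorem7 {d : ℕ} (hd : 1 ≤ d) (μ : ℕ → ℝ) (K : Set (EuclideanSpace ℝ (Fin d)))
    (hdata : Remez.IsAdmissibleData μ K)
    (N : ℕ) (hN : (N : ℕ∞) = Remez.associatedInteger μ K)
    (m : ℝ → ℝ) (hm : Remez.IsInterpolant m μ)
    (f : EuclideanSpace ℝ (Fin d) → ℝ)
    (hf : Remez.IsSmooth μ (2 * (N - 1)) (Remez.supNorm K f) K f)
    (t : ℝ) (ht : 0 < t) :
    volume {x | x ∈ K ∧ |f x| ≤ t} ≤
      if N = 1 then ⊤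
      else ENNReal.ofReal (Remez.Gam m (2 * (N - 1)) * d *
        (t / Remez.supNorm K f) ^ (1 / (2 * ((N : ℝ) - 1)))) * volume K := by
  obtain ⟨hN1, hδ, hsum⟩ := Remez.le_sum_of_associatedInteger hN
  split_ifs with hN'
  · exact le_top
  obtain ⟨n, rfl⟩ : ∃ n, N = n + 1 := ⟨N - 1, by omega⟩
  have hn : 1 ≤ n := by omega
  rw [Nat.add_sub_cancel] at hf ⊢
  have hnr : ((n + 1 : ℕ) : ℝ) - 1 = n := by push_cast; ring
  rw [hnr]
  obtain ⟨U, hU, hKU, hfU⟩ := hf.contDiff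
  have hK := hdata.body.compact
  have hfK : ContinuousOn f K := hfU.continuousOn.mono hKU
  have hM := hf.pos
  obtain ⟨x₀, hx₀, hmax⟩ : ∃ x₀ ∈ K, |f x₀| = Remez.supNorm K f :=
    hK.exists_sSup_image_eq (hdata.body.interior_nonempty.mono interior_subset) hfK.abs
      |>.imp fun x hx => ⟨hx.1, hx.2.symm⟩
  have hclosed : IsClosed {x | x ∈ K ∧ |f x| ≤ t} :=
    hfK.abs.preimage_isClosed_of_isClosed hK.isClosed isClosed_Iic
  have hτ : 0 ≤ (t / Remez.supNorm K f) ^ (1 / (2 * (n : ℝ))) := by positivity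
  have hmain := Remez.volume_le_of_rays hd hK hdata.body.convex hclosed (fun x hx => hx.1) hx₀
    (c := 4 * Real.exp 4 * (t / Remez.supNorm K f) ^ (1 / (2 * (n : ℝ)))) (by positivity) (by
      intro θ hθ l hl hlK
      have hseg : ∀ s ∈ Icc 0 l, x₀ + l • θ + s • -θ ∈ K := by
        intro s hs
        have h1 := hdata.body.convex.add_smul_sub_mem hlK hx₀ (t := s / l)
          ⟨div_nonneg hs.1 hl.le, (div_le_one hl).2 hs.2⟩
        rwa [sub_add_cancel_left, smul_neg, smul_smul, div_mul_cancel₀ _ hl.ne', ← smul_neg] at h1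
      have hlδ : l ≤ Metric.diam K := by
        have h1 := Metric.dist_le_diam_of_mem hK.isBounded hlK hx₀
        rw [dist_eq_norm, add_sub_cancel_left, norm_smul, hθ, mul_one] at h1
        exact (le_abs_self l).trans h1
      -- The segment is run from its far end towards `x₀`, so that the maximum sits at the right end
      -- point `l`; the reflection `r ↦ l - r` undoes this.
      have h1d := Remez.volume_sublevel_segment_le
        (G := fun j s => Remez.dirDeriv f (-θ) j (x₀ + l • θ + s • -θ))
        (hdata.weight.pos) (hdata.weight.mono) hl hn ht hM
        (fun j hj s hs => Remez.hasDerivAt_dirDeriv hU hfU _ _ hj (hKU (hseg s hs)))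
        (fun j hj s hs => (Remez.abs_dirDeriv_le_derivNorm hU hfU hK hKU (by rw [norm_neg, hθ])
          hj (hseg s hs)).trans (hf.bound j hj))
        (by rw [Remez.dirDeriv_zero, smul_neg, add_neg_cancel_right, hmax])
        (le_trans (by gcongr) hsum)
      have hpre : {r : ℝ | r ∈ Icc 0 l ∧ x₀ + r • θ ∈ {x | x ∈ K ∧ |f x| ≤ t}} ⊆
          (fun r => l - r) ⁻¹' {s | s ∈ Icc 0 l ∧
            |Remez.dirDeriv f (-θ) 0 (x₀ + l • θ + s • -θ)| ≤ t} := by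
        rintro r ⟨hr, -, hrt⟩
        refine ⟨⟨by linarith [hr.2], by linarith [hr.1]⟩, ?_⟩
        rw [Remez.dirDeriv_zero]
        have : x₀ + l • θ + (l - r) • -θ = x₀ + r • θ := by module
        rwa [this]
      refine (measure_mono hpre).trans ?_
      rw [(Measure.measurePreserving_sub_left volume l).measure_preimage_emb
        (MeasurableEquiv.subLeft l).measurableEmbedding]
      refine h1d.trans (le_of_eq ?_)
      congr 1
      ring)
  refine hmain.trans (mul_le_mul_left (ENNReal.ofReal_le_ofReal ?_) _)
  have hΓ : 4 * Real.exp 4 ≤ Remez.Gam m (2 * n) := by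
    unfold Remez.Gam
    have := Remez.gam_nonneg hm (2 * n)
    gcongr
    linarith
  rw [mul_right_comm]
  gcongr
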